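/- Fix a countably infinite, many-sorted set of names (with infinitely many names of each occurring sort); permutations are the sort-preserving bijections of names that move only finitely many names, and nominal sets, support, freshness $\#$ and equivariance are taken with respect to them. Consider a nominal transition system: nominal sets of states $P$, state predicates $\varphi$ and actions $\alpha$; an equivariant relation $P\vdash\varphi$; an equivariant function $\operatorname{bn}$ with $\operatorname{bn}(\alpha)$ a finite subset of $\operatorname{supp}(\alpha)$; and an equivariant transition relation $P\xrightarrow{\alpha}P'$ in which the names in $\operatorname{bn}(\alpha)$ bind into $\alpha$ and $P'$ (transitions relate states to alpha-equivalence classes of pairs $(\alpha,P')$). Let $\tau$ be an action with empty support, and let $\kappa$ be a cardinal greater than $\aleph_0$ and than the number of states. Formulas are $A ::= \bigwedge_{i\in I}A_i \mid \neg A\mid\varphi\mid\langle\alpha\rangle A$, where $\operatorname{bn}(\alpha)$ binds into $\alpha$ and $A$ in $\langle\alpha\rangle A$ (formulas are taken up to alpha-equivalence), and where a conjunction is that of a finitely supported set of fewer than $\kappa$ formulas. Validity $P\models A$ is as usual; $P\models\varphi$ iff $P\vdash\varphi$, and $P\models\langle\alpha\rangle A$ iff $P\xrightarrow{\alpha}P'$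 and $P'\models A$ for some $P'$, for a representative of $\langle\alpha\rangle A$ with $\operatorname{bn}(\alpha)\mathrel{\#}P$. Write $A\equiv B$ if $P\models A\Leftrightarrow P\models B$ for all states $P$. Let $\top$ be the empty conjunction, $\bigvee_i A_i=\neg\bigwedge_i\neg A_i$, $\langle\!\langle\tau\rangle\!\rangle A=\bigvee_{i\in\omega}\langle\tau\rangle^iA$, and $\langle\!\langle\alpha\rangle\!\rangle A=\langle\!\langle\tau\rangle\!\rangle\langle\alpha\rangle\langle\!\langle\tau\rangle\!\rangle A$ for $\alpha\ne\tau$. Weak formulas are those generated by $$A ::= \textstyle\bigwedge_{i\in I} A_i\mid\neg A\mid\langle\!\langle\alpha\rangle\!\rangle A\mid\langle\!\langle\tau\rangle\!\rangle(A\wedge\varphi).$$ Extended weak formulas $E$ and preformulas $B$ are generated by $$E ::= \textstyle\bigwedge_{i\in I} E_i\mid\neg E\mid\langle\!\langle\alpha\rangle\!\rangle E\mid\langle\!\langle\tau\rangle\!\rangle B,\qquad B ::= E\wedge B\mid\varphi\mid\textstyle\bigvee_{i\in I} B_i,$$ where conjunctions and disjunctions are over finitely supported sets of cardinality less than $\kappa$,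 and normal preformulas by $C ::= A\wedge\varphi\mid\bigvee_{i\in I}C_i$. Define $$\delta(A\wedge\varphi)=\langle\!\langle\tau\rangle\!\rangle(A\wedge\varphi),\quad \delta(\textstyle\bigvee_i C_i)=\bigvee_i\delta(C_i),\qquad \varepsilon(A,A'\wedge\varphi)=(A\wedge A')\wedge\varphi,\quad \varepsilon(A,\bigvee_i C_i)=\bigvee_i\varepsilon(A,C_i),$$ and, by mutual recursion on expressions of the grammar of $E$ and $B$ (up to alpha-equivalence), $$\Delta(\textstyle\bigwedge_i E_i)=\bigwedge_i\Delta(E_i),\quad \Delta(\neg E)=\neg\Delta(E),\quad \Delta(\langle\!\langle\alpha\rangle\!\rangle E)=\langle\!\langle\alpha\rangle\!\rangle\Delta(E),\quad \Delta(\langle\!\langle\tau\rangle\!\rangle B)=\delta(\Delta_{\mathrm{pre}}(B)),$$ $$\Delta_{\mathrm{pre}}(E\wedge B)=\varepsilon(\Delta(E),\Delta_{\mathrm{pre}}(B)),\quad \Delta_{\mathrm{pre}}(\varphi)=\top\wedge\varphi,\quad \Delta_{\mathrm{pre}}(\textstyle\bigvee_i B_i)=\bigvee_i\Delta_{\mathrm{pre}}(B_i).$$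 **Theorem.** $\Delta$ is a well-defined (all conjunctions and disjunctions on the right-hand sides are finitely supported, and alpha-equivalence is respected) equivariant function from extended weak formulas, as expressions of the grammar, to formulas, and for every extended weak formula $E$ the formula $\Delta(E)$ is an (ordinary) weak formula with $E\equiv\Delta(E)$. Moreover every formula $A$ that can be generated by the grammar of extended weak formulas, finite support being required of the resulting formula only, is the formula denoted by some such expression $E$, so that $A$ is equivalent to the weak formula $\Delta(E)$. -/

import Mathlib

open scoped Pointwise Cardinal
open Cardinal

universe u

namespace NominalHML

/-! ### Names, permutations, support, nominal sets -/

/-- A countably infinite, many-sorted set of names. Every sort that is inhabited has infinitely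
many names, so that fresh names of each sort are always available. -/
class NameSet (𝒩 : Type u) where
  /-- the sorts -/
  Srt : Type u
  /-- the sort of a name -/
  sort : 𝒩 → Srt
  countable : Countable 𝒩
  infinite : Infinite 𝒩
  infinite_sort : ∀ a, {b | sort b = sort a}.Infinite

/-- Permutations: sort-preserving bijections moving only finitely many names. -/
def permSubgroup (𝒩 : Type u) [NameSet 𝒩] : Subgroup (Equiv.Perm 𝒩) where
  carrier := {π | (∀ a, NameSet.sort (π a) = NameSet.sort a) ∧ {a | π a ≠ a}.Finite}
  one_mem' := by simp
  mul_mem' := by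
    rintro π ρ ⟨h1, h2⟩ ⟨h3, h4⟩
    refine ⟨fun a => by simp [h1, h3], (h2.union h4).subset ?_⟩
    intro a ha
    by_contra hc
    simp only [Set.mem_union, Set.mem_ofPred_eq, not_or, not_not] at hc
    exact ha (by simp [hc.2, hc.1])
  inv_mem' := by
    rintro π ⟨h1, h2⟩
    refine ⟨fun a => by simpa using (h1 (π⁻¹ a)).symm, h2.subset ?_⟩
    intro a ha hc
    exact ha (by rw [Equiv.Perm.inv_eq_iff_eq]; exact hc.symm)

/-- The group of permutations of names. -/
abbrev NPerm (𝒩 : Type u) [NameSet 𝒩] : Type u := permSubgroup 𝒩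

/-- A nominal set: a permutation action for which every element has a finite support. -/
class Nominal (𝒩 : Type u) [NameSet 𝒩] (X : Type u) extends MulAction (NPerm 𝒩) X where
  exists_support : ∀ x : X, ∃ N : Set 𝒩, N.Finite ∧ MulAction.Supports (NPerm 𝒩) N x

section Support

variable (𝒩 : Type u) [NameSet 𝒩] {X : Type*} [MulAction (NPerm 𝒩) X]

/-- The support of `x`: the least finite set of names supporting `x`. -/
def supp (x : X) : Set 𝒩 := ⋂₀ {N | N.Finite ∧ MulAction.Supports (NPerm 𝒩) N x}

/-- If `p` is the equivalence class of `x` for an equivariant equivalence relation, then this says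
that the names in `N` support the class `p`. -/
def ClassSupports (p : X → Prop) (x : X) (N : Set 𝒩) : Prop :=
  ∀ π : NPerm 𝒩, (∀ a ∈ N, π • a = a) → p (π • x)

/-- If `p` is the equivalence class of `x` for an equivariant equivalence relation, then this is
the support of the class `p`. -/
def classSupp (p : X → Prop) (x : X) : Set 𝒩 :=
  ⋂₀ {N | N.Finite ∧ ClassSupports 𝒩 p x N}

variable {𝒩}

theorem supp_smul_subset (π : NPerm 𝒩) (x : X) : supp 𝒩 (π • x) ⊆ π • supp 𝒩 x := by
  intro a ha
  rw [Set.mem_smul_set_iff_inv_smul_mem]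
  rintro N ⟨hN, hs⟩
  have h : a ∈ π • N := by
    apply ha
    refine ⟨hN.image _, fun ρ hρ => ?_⟩
    have := hs (π⁻¹ * ρ * π) (fun b hb => by
      have := hρ (Set.smul_mem_smul_set hb)
      rw [mul_smul, mul_smul, this, inv_smul_smul])
    rw [mul_smul, mul_smul, inv_smul_eq_iff] at this
    exact this
  rwa [Set.mem_smul_set_iff_inv_smul_mem] at h

theorem supp_smul (π : NPerm 𝒩) (x : X) : supp 𝒩 (π • x) = π • supp 𝒩 x := by
  refine (supp_smul_subset π x).antisymm ?_
  have := supp_smul_subset π⁻¹ (π • x)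
  rw [inv_smul_smul] at this
  rwa [Set.subset_smul_set_iff, inv_inv] at this

theorem classSupp_smul_subset {r : X → X → Prop}
    (x : X) (hr : ∀ (π : NPerm 𝒩) z, r x z → r (π • x) (π • z)) (π : NPerm 𝒩) :
    classSupp 𝒩 (r (π • x)) (π • x) ⊆ π • classSupp 𝒩 (r x) x := by
  intro a ha
  rw [Set.mem_smul_set_iff_inv_smul_mem]
  rintro N ⟨hN, hs⟩
  have h : a ∈ π • N := by
    apply ha
    refine ⟨hN.image _, fun ρ hρ => ?_⟩
    have := hr π _ (hs (π⁻¹ * ρ * π) (fun b hb => by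
      have := hρ _ (Set.smul_mem_smul_set hb)
      rw [mul_smul, mul_smul, this, inv_smul_smul]))
    rwa [mul_smul, mul_smul, smul_inv_smul] at this
  rwa [Set.mem_smul_set_iff_inv_smul_mem] at h

theorem classSupp_smul {r : X → X → Prop}
    (hr : ∀ (π : NPerm 𝒩) y z, r y z → r (π • y) (π • z))
    (π : NPerm 𝒩) (x : X) :
    classSupp 𝒩 (r (π • x)) (π • x) = π • classSupp 𝒩 (r x) x := by
  refine (classSupp_smul_subset x (fun π => hr π x) π).antisymm ?_
  have := classSupp_smul_subset (π • x) (fun ρ => hr ρ _) π⁻¹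
  rw [inv_smul_smul] at this
  rwa [Set.subset_smul_set_iff, inv_inv] at this

theorem classSupp_congr {r : X → X → Prop}
    (hr : ∀ (π : NPerm 𝒩) y z, r y z → r (π • y) (π • z)) {x y : X} (hx : r x x)
    (hE : ∀ y z, r x y → r x z → r y z) (hT : ∀ y z, r x y → r y z → r x z) (h : r x y) :
    classSupp 𝒩 (r x) x = classSupp 𝒩 (r y) y := by
  unfold classSupp
  congr 1
  ext N
  refine and_congr_right fun _ => ⟨fun hN π hπ => ?_, fun hN π hπ => ?_⟩
  · exact hE _ _ h (hT _ _ (hN π hπ) (hr π _ _ h))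
  · exact hT _ _ (hT _ _ h (hN π hπ)) (hr π _ _ (hE _ _ h hx))

end Support

/-! ### Name abstraction and nominal transition systems -/

section Abs

variable (𝒩 : Type u) [NameSet 𝒩] (X : Type u) [MulAction (NPerm 𝒩) X]

/-- Nominal alpha-equivalence on pairs of a finite set of names and an element. -/
def absSetoid : Setoid (Finset 𝒩 × X) where
  r p q := ∃ π : NPerm 𝒩, π • (p.1 : Set 𝒩) = q.1 ∧ π • p.2 = q.2 ∧
    ∀ a ∈ supp 𝒩 p.2 \ (p.1 : Set 𝒩), π • a = a
  iseqv := by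
    refine ⟨fun p => ⟨1, by simp⟩, ?_, ?_⟩
    · rintro p q ⟨π, h1, h2, h3⟩
      refine ⟨π⁻¹, by rw [← h1, inv_smul_smul], by rw [← h2, inv_smul_smul], ?_⟩
      rintro a ⟨ha, hb⟩
      rw [← h2, supp_smul, Set.mem_smul_set_iff_inv_smul_mem] at ha
      rw [← h1, Set.mem_smul_set_iff_inv_smul_mem] at hb
      have := h3 _ ⟨ha, hb⟩
      rw [smul_inv_smul] at this
      exact this.symm
    · rintro p q s ⟨π, h1, h2, h3⟩ ⟨ρ, k1, k2, k3⟩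
      refine ⟨ρ * π, by rw [mul_smul, h1, k1], by rw [mul_smul, h2, k2], ?_⟩
      rintro a ⟨ha, hb⟩
      have h := h3 a ⟨ha, hb⟩
      rw [mul_smul, h]
      refine k3 a ⟨?_, ?_⟩
      · rw [← h2, supp_smul, ← h]
        exact Set.smul_mem_smul_set ha
      · rw [← h1, ← h, Set.smul_mem_smul_set_iff]
        exact hb

/-- Generalised name abstraction: pairs `(N, x)` up to alpha-conversion of the names in `N`. -/
def NameAbs : Type u := Quotient (absSetoid 𝒩 X)

variable {𝒩 X}

/-- The abstraction of the names `N` in `x`. -/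
def NameAbs.mk (N : Finset 𝒩) (x : X) : NameAbs 𝒩 X := Quotient.mk (absSetoid 𝒩 X) (N, x)

end Abs

/-- A nominal transition system with a distinguished unobservable action `τ` of empty support. -/
structure NTS (𝒩 State Pred Act : Type u) [NameSet 𝒩] [Nominal 𝒩 State] [Nominal 𝒩 Pred]
    [Nominal 𝒩 Act] where
  /-- `entails P φ`: the state predicate `φ` holds in the state `P` -/
  entails : State → Pred → Prop
  entails_smul : ∀ (π : NPerm 𝒩) P φ, entails P φ → entails (π • P) (π • φ)
  /-- the binding names of an action -/
  bn : Act → Finset 𝒩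
  bn_smul : ∀ (π : NPerm 𝒩) α, (bn (π • α) : Set 𝒩) = π • (bn α : Set 𝒩)
  bn_subset : ∀ α, (bn α : Set 𝒩) ⊆ supp 𝒩 α
  /-- the transition relation, between states and residuals -/
  trans : Set (State × NameAbs 𝒩 (Act × State))
  bn_of_trans : ∀ P N α Q, (P, NameAbs.mk N (α, Q)) ∈ trans → bn α = N
  trans_smul : ∀ (π : NPerm 𝒩) P α Q, (P, NameAbs.mk (bn α) (α, Q)) ∈ trans →
    (π • P, NameAbs.mk (bn (π • α)) (π • α, π • Q)) ∈ trans
  /-- the unobservable action -/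
  tau : Act
  tau_smul : ∀ π : NPerm 𝒩, π • tau = tau

variable {𝒩 State Pred Act : Type u} [NameSet 𝒩] [Nominal 𝒩 State] [Nominal 𝒩 Pred]
  [Nominal 𝒩 Act]

/-- The transition `P --α--> Q`. -/
def NTS.Step (T : NTS 𝒩 State Pred Act) (P : State) (α : Act) (Q : State) : Prop :=
  (P, NameAbs.mk (T.bn α) (α, Q)) ∈ T.trans

/-! ### Raw syntax

Formulas are raw expressions modulo alpha-equivalence (which also identifies conjunctions with the
same set of conjuncts), subject to hereditary finite support. -/

/-- Raw Hennessy-Milner formulas, with conjunctions of fewer than `κ` conjuncts. -/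
inductive Raw (Pred Act : Type u) (κ : Cardinal.{u}) : Type (u + 1)
  | conj (ι : Type u) (hι : #ι < κ) (f : ι → Raw Pred Act κ)
  | neg (A : Raw Pred Act κ)
  | pred (φ : Pred)
  | may (α : Act) (A : Raw Pred Act κ)

mutual
/-- Raw expressions of the grammar of extended weak formulas
`E ::= ⋀ Eᵢ | ¬ E | ⟪α⟫ E | ⟪τ⟫ B`. -/
inductive ERaw (Pred Act : Type u) (κ : Cardinal.{u}) : Type (u + 1)
  | conj (ι : Type u) (hι : #ι < κ) (f : ι → ERaw Pred Act κ)
  | neg (E : ERaw Pred Act κ)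
  | wmay (α : Act) (E : ERaw Pred Act κ)
  | wtau (B : BRaw Pred Act κ)
/-- Raw expressions of the grammar of preformulas `B ::= E ∧ B | φ | ⋁ Bᵢ`. -/
inductive BRaw (Pred Act : Type u) (κ : Cardinal.{u}) : Type (u + 1)
  | and (E : ERaw Pred Act κ) (B : BRaw Pred Act κ)
  | pred (φ : Pred)
  | disj (ι : Type u) (hι : #ι < κ) (f : ι → BRaw Pred Act κ)
end

/-- Raw expressions of the grammar of normal preformulas `C ::= A ∧ φ | ⋁ Cᵢ`. -/
inductive NRaw (Pred Act : Type u) (κ : Cardinal.{u}) : Type (u + 1)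
  | leaf (A : Raw Pred Act κ) (φ : Pred)
  | disj (ι : Type u) (hι : #ι < κ) (f : ι → NRaw Pred Act κ)

variable {κ : Cardinal.{u}}

/-! Permutations distribute over all constructors. -/

/-- Permutation of raw formulas. -/
def Raw.perm (π : NPerm 𝒩) : Raw Pred Act κ → Raw Pred Act κ
  | .conj ι h f => .conj ι h fun i => (f i).perm π
  | .neg A => .neg (A.perm π)
  | .pred φ => .pred (π • φ)
  | .may α A => .may (π • α) (A.perm π)

mutual
/-- Permutation of raw extended weak formulas. -/
def ERaw.perm (π : NPerm 𝒩) : ERaw Pred Act κ → ERaw Pred Act κ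
  | .conj ι h f => .conj ι h fun i => (f i).perm π
  | .neg E => .neg (E.perm π)
  | .wmay α E => .wmay (π • α) (E.perm π)
  | .wtau B => .wtau (B.perm π)
/-- Permutation of raw preformulas. -/
def BRaw.perm (π : NPerm 𝒩) : BRaw Pred Act κ → BRaw Pred Act κ
  | .and E B => .and (E.perm π) (B.perm π)
  | .pred φ => .pred (π • φ)
  | .disj ι h f => .disj ι h fun i => (f i).perm π
end

theorem Raw.perm_one (A : Raw Pred Act κ) : A.perm (1 : NPerm 𝒩) = A := by
  induction A with
  | conj ι h f ih => simp [Raw.perm, ih]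
  | neg A ih => simp [Raw.perm, ih]
  | pred φ => simp [Raw.perm]
  | may α A ih => simp [Raw.perm, ih]

theorem Raw.perm_mul (π ρ : NPerm 𝒩) (A : Raw Pred Act κ) :
    A.perm (π * ρ) = (A.perm ρ).perm π := by
  induction A with
  | conj ι h f ih => simp [Raw.perm, ih]
  | neg A ih => simp [Raw.perm, ih]
  | pred φ => simp [Raw.perm, mul_smul]
  | may α A ih => simp [Raw.perm, ih, mul_smul]

mutual
theorem ERaw.perm_one : ∀ E : ERaw Pred Act κ, E.perm (1 : NPerm 𝒩) = E
  | .conj ι h f => by simp [ERaw.perm, fun i => ERaw.perm_one (f i)]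
  | .neg E => by simp [ERaw.perm, ERaw.perm_one E]
  | .wmay α E => by simp [ERaw.perm, ERaw.perm_one E]
  | .wtau B => by simp [ERaw.perm, BRaw.perm_one B]
theorem BRaw.perm_one : ∀ B : BRaw Pred Act κ, B.perm (1 : NPerm 𝒩) = B
  | .and E B => by simp [BRaw.perm, ERaw.perm_one E, BRaw.perm_one B]
  | .pred φ => by simp [BRaw.perm]
  | .disj ι h f => by simp [BRaw.perm, fun i => BRaw.perm_one (f i)]
end

mutual
theorem ERaw.perm_mul (π ρ : NPerm 𝒩) :
    ∀ E : ERaw Pred Act κ, E.perm (π * ρ) = (E.perm ρ).perm π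
  | .conj ι h f => by simp [ERaw.perm, fun i => ERaw.perm_mul π ρ (f i)]
  | .neg E => by simp [ERaw.perm, ERaw.perm_mul π ρ E]
  | .wmay α E => by simp [ERaw.perm, ERaw.perm_mul π ρ E, mul_smul]
  | .wtau B => by simp [ERaw.perm, BRaw.perm_mul π ρ B]
theorem BRaw.perm_mul (π ρ : NPerm 𝒩) :
    ∀ B : BRaw Pred Act κ, B.perm (π * ρ) = (B.perm ρ).perm π
  | .and E B => by simp [BRaw.perm, ERaw.perm_mul π ρ E, BRaw.perm_mul π ρ B]
  | .pred φ => by simp [BRaw.perm, mul_smul]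
  | .disj ι h f => by simp [BRaw.perm, fun i => BRaw.perm_mul π ρ (f i)]
end

instance : MulAction (NPerm 𝒩) (Raw Pred Act κ) where
  smul π A := A.perm π
  one_smul := Raw.perm_one
  mul_smul := Raw.perm_mul

instance : MulAction (NPerm 𝒩) (ERaw Pred Act κ) where
  smul π A := A.perm π
  one_smul := ERaw.perm_one
  mul_smul := ERaw.perm_mul

instance : MulAction (NPerm 𝒩) (BRaw Pred Act κ) where
  smul π A := A.perm π
  one_smul := BRaw.perm_one
  mul_smul := BRaw.perm_mul

section SmulLemmas
variable (π : NPerm 𝒩)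
@[simp] theorem Raw.smul_conj (ι : Type u) (h : #ι < κ) (f : ι → Raw Pred Act κ) :
    π • Raw.conj ι h f = Raw.conj ι h fun i => π • f i := rfl
@[simp] theorem Raw.smul_neg (A : Raw Pred Act κ) : π • Raw.neg A = Raw.neg (π • A) := rfl
@[simp] theorem Raw.smul_pred (φ : Pred) :
    π • (Raw.pred φ : Raw Pred Act κ) = Raw.pred (π • φ) := rfl
@[simp] theorem Raw.smul_may (α : Act) (A : Raw Pred Act κ) :
    π • Raw.may α A = Raw.may (π • α) (π • A) := rfl
@[simp] theorem ERaw.smul_conj (ι : Type u) (h : #ι < κ) (f : ι → ERaw Pred Act κ) :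
    π • ERaw.conj ι h f = ERaw.conj ι h fun i => π • f i := by
  change ERaw.perm π _ = _
  rw [ERaw.perm]; rfl
@[simp] theorem ERaw.smul_neg (A : ERaw Pred Act κ) : π • ERaw.neg A = ERaw.neg (π • A) := by
  change ERaw.perm π _ = _
  rw [ERaw.perm]; rfl
@[simp] theorem ERaw.smul_wmay (α : Act) (A : ERaw Pred Act κ) :
    π • ERaw.wmay α A = ERaw.wmay (π • α) (π • A) := by
  change ERaw.perm π _ = _
  rw [ERaw.perm]; rfl
@[simp] theorem ERaw.smul_wtau (B : BRaw Pred Act κ) : π • ERaw.wtau B = ERaw.wtau (π • B) := by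
  change ERaw.perm π _ = _
  rw [ERaw.perm]; rfl
@[simp] theorem BRaw.smul_and (E : ERaw Pred Act κ) (B : BRaw Pred Act κ) :
    π • BRaw.and E B = BRaw.and (π • E) (π • B) := by
  change BRaw.perm π _ = _
  rw [BRaw.perm]; rfl
@[simp] theorem BRaw.smul_pred (φ : Pred) :
    π • (BRaw.pred φ : BRaw Pred Act κ) = BRaw.pred (π • φ) := by
  change BRaw.perm π _ = _
  rw [BRaw.perm]
@[simp] theorem BRaw.smul_disj (ι : Type u) (h : #ι < κ) (f : ι → BRaw Pred Act κ) :
    π • BRaw.disj ι h f = BRaw.disj ι h fun i => π • f i := by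
  change BRaw.perm π _ = _
  rw [BRaw.perm]; rfl
end SmulLemmas

/-! ### Alpha-equivalence -/

/-- Two families have the same set of members, `p i` being the equivalence class of the `i`-th
member of the first family and `g` being the second family. -/
def SameSet {ι ι' : Type u} {X : Type*} (p : ι → X → Prop) (g : ι' → X) : Prop :=
  (∀ i, ∃ j, p i (g j)) ∧ ∀ j, ∃ i, p i (g j)

/-- Alpha-equivalence of `α.x` and `β.y`, where the names in `bn α` bind into `α` and `x`, and
where `p` is the equivalence class of `x`: some `π` with `π • α = β` and `π • x ≈ y` fixes the
names in `supp(α, x) \ bn(α)`. (Instead of `π • x ≈ y` we write the equivalent `x ≈ π⁻¹ • y`.) -/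
def SameAbs (T : NTS 𝒩 State Pred Act) {X : Type*} [MulAction (NPerm 𝒩) X]
    (α : Act) (p : X → Prop) (x : X) (β : Act) (y : X) : Prop :=
  ∃ π : NPerm 𝒩, π • α = β ∧ p (π⁻¹ • y) ∧
    ∀ a ∈ (supp 𝒩 α ∪ classSupp 𝒩 p x) \ (T.bn α : Set 𝒩), π • a = a

/-- Alpha-equivalence of raw formulas. -/
def Raw.Alpha (T : NTS 𝒩 State Pred Act) : Raw Pred Act κ → Raw Pred Act κ → Prop
  | .conj _ _ f, .conj _ _ g => SameSet (fun i => (f i).Alpha T) g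
  | .neg A, .neg B => A.Alpha T B
  | .pred φ, .pred ψ => φ = ψ
  | .may α A, .may β B => SameAbs T α (A.Alpha T) A β B
  | _, _ => False

mutual
/-- Alpha-equivalence of raw extended weak formulas. -/
def ERaw.Alpha (T : NTS 𝒩 State Pred Act) : ERaw Pred Act κ → ERaw Pred Act κ → Prop
  | .conj _ _ f, .conj _ _ g => SameSet (fun i => (f i).Alpha T) g
  | .neg A, .neg B => A.Alpha T B
  | .wmay α A, .wmay β B => SameAbs T α (A.Alpha T) A β B
  | .wtau A, .wtau B => A.Alpha T B
  | _, _ => False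
/-- Alpha-equivalence of raw preformulas. -/
def BRaw.Alpha (T : NTS 𝒩 State Pred Act) : BRaw Pred Act κ → BRaw Pred Act κ → Prop
  | .and E B, .and E' B' => E.Alpha T E' ∧ B.Alpha T B'
  | .pred φ, .pred ψ => φ = ψ
  | .disj _ _ f, .disj _ _ g => SameSet (fun i => (f i).Alpha T) g
  | _, _ => False
end

section AlphaLemmas

variable {T : NTS 𝒩 State Pred Act} {X : Type*}

theorem SameSet.refl {r : X → X → Prop} {ι : Type u} {f : ι → X} (h : ∀ i, r (f i) (f i)) :
    SameSet (fun i => r (f i)) f := ⟨fun i => ⟨i, h i⟩, fun i => ⟨i, h i⟩⟩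

theorem SameSet.euclid {r : X → X → Prop} {ι ι' ι'' : Type u} {f : ι → X} {g : ι' → X}
    {k : ι'' → X} (hE : ∀ i y z, r (f i) y → r (f i) z → r y z)
    (h : SameSet (fun i => r (f i)) g) (h' : SameSet (fun i => r (f i)) k) :
    SameSet (fun i => r (g i)) k := by
  refine ⟨fun j => ?_, fun j => ?_⟩
  · obtain ⟨i, hi⟩ := h.2 j
    obtain ⟨l, hl⟩ := h'.1 i
    exact ⟨l, hE i _ _ hi hl⟩
  · obtain ⟨i, hi⟩ := h'.2 j
    obtain ⟨l, hl⟩ := h.1 i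
    exact ⟨l, hE i _ _ hl hi⟩

theorem SameSet.trans {r : X → X → Prop} {ι ι' ι'' : Type u} {f : ι → X} {g : ι' → X}
    {k : ι'' → X} (hT : ∀ i y z, r (f i) y → r y z → r (f i) z)
    (h : SameSet (fun i => r (f i)) g) (h' : SameSet (fun i => r (g i)) k) :
    SameSet (fun i => r (f i)) k := by
  refine ⟨fun j => ?_, fun j => ?_⟩
  · obtain ⟨i, hi⟩ := h.1 j
    obtain ⟨l, hl⟩ := h'.1 i
    exact ⟨l, hT j _ _ hi hl⟩
  · obtain ⟨i, hi⟩ := h'.2 j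
    obtain ⟨l, hl⟩ := h.2 i
    exact ⟨l, hT _ _ _ hl hi⟩

theorem SameSet.map {Y : Type*} {r : X → X → Prop} {s : Y → Y → Prop} {ι ι' : Type u}
    {f : ι → X} {g : ι' → X} {f' : ι → Y} {g' : ι' → Y}
    (hm : ∀ i j, r (f i) (g j) → s (f' i) (g' j))
    (h : SameSet (fun i => r (f i)) g) : SameSet (fun i => s (f' i)) g' :=
  ⟨fun i => (h.1 i).imp fun j => hm i j, fun j => (h.2 j).imp fun i => hm i j⟩

variable [MulAction (NPerm 𝒩) X]

theorem SameAbs.smul {r : X → X → Prop} {α β : Act} {x y : X}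
    (hx : ∀ (π : NPerm 𝒩) z, r x z → r (π • x) (π • z)) (h : SameAbs T α (r x) x β y)
    (π : NPerm 𝒩) : SameAbs T (π • α) (r (π • x)) (π • x) (π • β) (π • y) := by
  obtain ⟨σ, h1, h2, h3⟩ := h
  refine ⟨π * σ * π⁻¹, by simp [mul_smul, h1], ?_, ?_⟩
  · have := hx π _ h2
    simpa [mul_smul] using this
  · rintro a ⟨ha, hb⟩
    have : π⁻¹ • a ∈ supp 𝒩 α ∪ classSupp 𝒩 (r x) x := by
      rw [← Set.mem_smul_set_iff_inv_smul_mem, Set.smul_set_union]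
      rcases ha with ha | ha
      · exact Or.inl (supp_smul_subset _ _ ha)
      · exact Or.inr (classSupp_smul_subset x hx π ha)
    have h := h3 _ ⟨this, fun hc => hb (by
      rw [T.bn_smul, Set.mem_smul_set_iff_inv_smul_mem]; exact hc)⟩
    rw [mul_smul, mul_smul, h, smul_inv_smul]

theorem SameAbs.refl {r : X → X → Prop} {α : Act} {x : X} (hx : r x x) :
    SameAbs T α (r x) x α x := ⟨1, by simp, by simpa using hx, by simp⟩

theorem SameAbs.euclid {r : X → X → Prop}
    (hr : ∀ (π : NPerm 𝒩) y z, r y z → r (π • y) (π • z)) {x : X} (hx : r x x)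
    (hE : ∀ y z, r x y → r x z → r y z) (hT : ∀ y z, r x y → r y z → r x z)
    {α β γ : Act} {y z : X} (h : SameAbs T α (r x) x β y) (h' : SameAbs T α (r x) x γ z) :
    SameAbs T β (r y) y γ z := by
  obtain ⟨σ, h1, h2, h3⟩ := h
  obtain ⟨θ, k1, k2, k3⟩ := h'
  refine ⟨θ * σ⁻¹, by rw [← h1, mul_smul, inv_smul_smul, k1], ?_, ?_⟩
  · have := hr σ _ _ (hE _ _ h2 k2)
    simpa [mul_smul] using this
  · rintro a ⟨ha, hb⟩
    have hs : classSupp 𝒩 (r y) y = σ • classSupp 𝒩 (r x) x := by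
      rw [classSupp_congr hr hx hE hT h2, ← classSupp_smul hr, smul_inv_smul]
    rw [hs, ← h1, supp_smul, ← Set.smul_set_union, Set.mem_smul_set_iff_inv_smul_mem] at ha
    rw [← h1, T.bn_smul, Set.mem_smul_set_iff_inv_smul_mem] at hb
    have e1 := h3 _ ⟨ha, hb⟩
    have e2 := k3 _ ⟨ha, hb⟩
    rw [smul_inv_smul] at e1
    rw [mul_smul, e2, ← e1]

theorem SameAbs.trans {r : X → X → Prop}
    (hr : ∀ (π : NPerm 𝒩) y z, r y z → r (π • y) (π • z)) {x : X} (hx : r x x)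
    (hE : ∀ y z, r x y → r x z → r y z) (hT : ∀ y z, r x y → r y z → r x z)
    {α β γ : Act} {y z : X} (h : SameAbs T α (r x) x β y) (h' : SameAbs T β (r y) y γ z) :
    SameAbs T α (r x) x γ z := by
  obtain ⟨σ, h1, h2, h3⟩ := h
  obtain ⟨θ, k1, k2, k3⟩ := h'
  refine ⟨θ * σ, by rw [mul_smul, h1, k1], ?_, ?_⟩
  · have := hT _ _ h2 (hr σ⁻¹ _ _ k2)
    simpa [mul_smul] using this
  · rintro a ⟨ha, hb⟩
    have hs : classSupp 𝒩 (r y) y = σ • classSupp 𝒩 (r x) x := by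
      rw [classSupp_congr hr hx hE hT h2, ← classSupp_smul hr, smul_inv_smul]
    have e1 := h3 _ ⟨ha, hb⟩
    rw [mul_smul, e1]
    refine k3 a ⟨?_, ?_⟩
    · rw [hs, ← h1, supp_smul, ← Set.smul_set_union, ← e1]
      exact Set.smul_mem_smul_set ha
    · rw [← h1, T.bn_smul, ← e1, Set.smul_mem_smul_set_iff]
      exact hb

/-- A map that is equivariant and respects the equivalences respects abstractions. -/
theorem SameAbs.map {Y : Type*} [MulAction (NPerm 𝒩) Y] {r : X → X → Prop} {s : Y → Y → Prop}
    {F : X → Y} (hF : ∀ (π : NPerm 𝒩) x, F (π • x) = π • F x) {x y : X}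
    (hm : ∀ z, r x z → s (F x) (F z)) {α β : Act} (h : SameAbs T α (r x) x β y) :
    SameAbs T α (s (F x)) (F x) β (F y) := by
  obtain ⟨σ, h1, h2, h3⟩ := h
  refine ⟨σ, h1, ?_, ?_⟩
  · rw [← hF]
    exact hm _ h2
  · rintro a ⟨ha, hb⟩
    refine h3 a ⟨ha.imp_right fun ha N hN => ha N ⟨hN.1, fun π hπ => ?_⟩, hb⟩
    rw [← hF]
    exact hm _ (hN.2 π hπ)

theorem Raw.Alpha.refl : ∀ A : Raw Pred Act κ, A.Alpha T A
  | .conj _ _ f => by rw [Raw.Alpha]; exact SameSet.refl fun i => Raw.Alpha.refl (f i)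
  | .neg A => by rw [Raw.Alpha]; exact Raw.Alpha.refl A
  | .pred φ => by rw [Raw.Alpha]
  | .may α A => by rw [Raw.Alpha]; exact SameAbs.refl (Raw.Alpha.refl A)

theorem Raw.Alpha.smul : ∀ {A : Raw Pred Act κ} (π : NPerm 𝒩) (B : Raw Pred Act κ),
    A.Alpha T B → (π • A).Alpha T (π • B)
  | .conj _ _ f, π, B, h => by
    cases B <;> simp only [Raw.Alpha, Raw.smul_conj] at h ⊢
    exact h.map fun i j => Raw.Alpha.smul π _
  | .neg A, π, B, h => by
    cases B <;> simp only [Raw.Alpha, Raw.smul_neg] at h ⊢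
    exact Raw.Alpha.smul π _ h
  | .pred φ, π, B, h => by
    cases B <;> simp only [Raw.Alpha, Raw.smul_pred] at h ⊢
    rw [h]
  | .may α A, π, B, h => by
    cases B <;> simp only [Raw.Alpha, Raw.smul_may] at h ⊢
    exact h.smul (fun π z => Raw.Alpha.smul π z) π

theorem Raw.Alpha.euclid_trans : ∀ A : Raw Pred Act κ,
    (∀ B C : Raw Pred Act κ, A.Alpha T B → A.Alpha T C → B.Alpha T C) ∧
    (∀ B C : Raw Pred Act κ, A.Alpha T B → B.Alpha T C → A.Alpha T C)
  | .conj _ _ f => by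
    have ih := fun i => Raw.Alpha.euclid_trans (f i)
    refine ⟨fun B C h h' => ?_, fun B C h h' => ?_⟩ <;>
      cases B <;> cases C <;> simp only [Raw.Alpha] at h h' ⊢
    · exact h.euclid (fun i => (ih i).1) h'
    · exact h.trans (fun i => (ih i).2) h'
  | .neg A => by
    have ih := Raw.Alpha.euclid_trans A
    refine ⟨fun B C h h' => ?_, fun B C h h' => ?_⟩ <;>
      cases B <;> cases C <;> simp only [Raw.Alpha] at h h' ⊢
    · exact ih.1 _ _ h h'
    · exact ih.2 _ _ h h'
  | .pred φ => by
    refine ⟨fun B C h h' => ?_, fun B C h h' => ?_⟩ <;>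
      cases B <;> cases C <;> simp only [Raw.Alpha] at h h' ⊢
    · exact h.symm.trans h'
    · exact h.trans h'
  | .may α A => by
    have ih := Raw.Alpha.euclid_trans A
    refine ⟨fun B C h h' => ?_, fun B C h h' => ?_⟩ <;>
      cases B <;> cases C <;> simp only [Raw.Alpha] at h h' ⊢
    · exact h.euclid (fun π y z => Raw.Alpha.smul π z) (Raw.Alpha.refl A) ih.1 ih.2 h'
    · exact h.trans (fun π y z => Raw.Alpha.smul π z) (Raw.Alpha.refl A) ih.1 ih.2 h'

theorem Raw.Alpha.symm {A B : Raw Pred Act κ} (h : A.Alpha T B) : B.Alpha T A :=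
  (Raw.Alpha.euclid_trans A).1 _ _ h (Raw.Alpha.refl A)

theorem Raw.Alpha.trans {A B C : Raw Pred Act κ} (h : A.Alpha T B) (h' : B.Alpha T C) :
    A.Alpha T C := (Raw.Alpha.euclid_trans A).2 _ _ h h'

mutual
theorem ERaw.Alpha.refl : ∀ A : ERaw Pred Act κ, A.Alpha T A
  | .conj _ _ f => by rw [ERaw.Alpha]; exact SameSet.refl fun i => ERaw.Alpha.refl (f i)
  | .neg A => by rw [ERaw.Alpha]; exact ERaw.Alpha.refl A
  | .wmay α A => by rw [ERaw.Alpha]; exact SameAbs.refl (ERaw.Alpha.refl A)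
  | .wtau B => by rw [ERaw.Alpha]; exact BRaw.Alpha.refl B
theorem BRaw.Alpha.refl : ∀ A : BRaw Pred Act κ, A.Alpha T A
  | .and E B => by rw [BRaw.Alpha]; exact ⟨ERaw.Alpha.refl E, BRaw.Alpha.refl B⟩
  | .pred φ => by rw [BRaw.Alpha]
  | .disj _ _ f => by rw [BRaw.Alpha]; exact SameSet.refl fun i => BRaw.Alpha.refl (f i)
end

mutual
theorem ERaw.Alpha.smul : ∀ {A : ERaw Pred Act κ} (π : NPerm 𝒩) (B : ERaw Pred Act κ),
    A.Alpha T B → (π • A).Alpha T (π • B)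
  | .conj _ _ f, π, B, h => by
    cases B <;> simp only [ERaw.Alpha, ERaw.smul_conj] at h ⊢
    exact h.map fun i j => ERaw.Alpha.smul π _
  | .neg A, π, B, h => by
    cases B <;> simp only [ERaw.Alpha, ERaw.smul_neg] at h ⊢
    exact ERaw.Alpha.smul π _ h
  | .wmay α A, π, B, h => by
    cases B <;> simp only [ERaw.Alpha, ERaw.smul_wmay] at h ⊢
    exact h.smul (fun π z => ERaw.Alpha.smul π z) π
  | .wtau A, π, B, h => by
    cases B <;> simp only [ERaw.Alpha, ERaw.smul_wtau] at h ⊢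
    exact BRaw.Alpha.smul π _ h
theorem BRaw.Alpha.smul : ∀ {A : BRaw Pred Act κ} (π : NPerm 𝒩) (B : BRaw Pred Act κ),
    A.Alpha T B → (π • A).Alpha T (π • B)
  | .and E A, π, B, h => by
    cases B <;> simp only [BRaw.Alpha, BRaw.smul_and] at h ⊢
    exact ⟨ERaw.Alpha.smul π _ h.1, BRaw.Alpha.smul π _ h.2⟩
  | .pred φ, π, B, h => by
    cases B <;> simp only [BRaw.Alpha, BRaw.smul_pred] at h ⊢
    rw [h]
  | .disj _ _ f, π, B, h => by
    cases B <;> simp only [BRaw.Alpha, BRaw.smul_disj] at h ⊢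
    exact h.map fun i j => BRaw.Alpha.smul π _
end

mutual
theorem ERaw.Alpha.euclid_trans : ∀ A : ERaw Pred Act κ,
    (∀ B C : ERaw Pred Act κ, A.Alpha T B → A.Alpha T C → B.Alpha T C) ∧
    (∀ B C : ERaw Pred Act κ, A.Alpha T B → B.Alpha T C → A.Alpha T C)
  | .conj _ _ f => by
    have ih := fun i => ERaw.Alpha.euclid_trans (f i)
    refine ⟨fun B C h h' => ?_, fun B C h h' => ?_⟩ <;>
      cases B <;> cases C <;> simp only [ERaw.Alpha] at h h' ⊢
    · exact h.euclid (fun i => (ih i).1) h'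
    · exact h.trans (fun i => (ih i).2) h'
  | .neg A => by
    have ih := ERaw.Alpha.euclid_trans A
    refine ⟨fun B C h h' => ?_, fun B C h h' => ?_⟩ <;>
      cases B <;> cases C <;> simp only [ERaw.Alpha] at h h' ⊢
    · exact ih.1 _ _ h h'
    · exact ih.2 _ _ h h'
  | .wmay α A => by
    have ih := ERaw.Alpha.euclid_trans A
    refine ⟨fun B C h h' => ?_, fun B C h h' => ?_⟩ <;>
      cases B <;> cases C <;> simp only [ERaw.Alpha] at h h' ⊢
    · exact h.euclid (fun π y z => ERaw.Alpha.smul π z) (ERaw.Alpha.refl A) ih.1 ih.2 h'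
    · exact h.trans (fun π y z => ERaw.Alpha.smul π z) (ERaw.Alpha.refl A) ih.1 ih.2 h'
  | .wtau A => by
    have ih := BRaw.Alpha.euclid_trans A
    refine ⟨fun B C h h' => ?_, fun B C h h' => ?_⟩ <;>
      cases B <;> cases C <;> simp only [ERaw.Alpha] at h h' ⊢
    · exact ih.1 _ _ h h'
    · exact ih.2 _ _ h h'
theorem BRaw.Alpha.euclid_trans : ∀ A : BRaw Pred Act κ,
    (∀ B C : BRaw Pred Act κ, A.Alpha T B → A.Alpha T C → B.Alpha T C) ∧
    (∀ B C : BRaw Pred Act κ, A.Alpha T B → B.Alpha T C → A.Alpha T C)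
  | .and E A => by
    have ih := BRaw.Alpha.euclid_trans A
    have ih' := ERaw.Alpha.euclid_trans E
    refine ⟨fun B C h h' => ?_, fun B C h h' => ?_⟩ <;>
      cases B <;> cases C <;> simp only [BRaw.Alpha] at h h' ⊢
    · exact ⟨ih'.1 _ _ h.1 h'.1, ih.1 _ _ h.2 h'.2⟩
    · exact ⟨ih'.2 _ _ h.1 h'.1, ih.2 _ _ h.2 h'.2⟩
  | .pred φ => by
    refine ⟨fun B C h h' => ?_, fun B C h h' => ?_⟩ <;>
      cases B <;> cases C <;> simp only [BRaw.Alpha] at h h' ⊢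
    · exact h.symm.trans h'
    · exact h.trans h'
  | .disj _ _ f => by
    have ih := fun i => BRaw.Alpha.euclid_trans (f i)
    refine ⟨fun B C h h' => ?_, fun B C h h' => ?_⟩ <;>
      cases B <;> cases C <;> simp only [BRaw.Alpha] at h h' ⊢
    · exact h.euclid (fun i => (ih i).1) h'
    · exact h.trans (fun i => (ih i).2) h'
end

theorem ERaw.Alpha.symm {A B : ERaw Pred Act κ} (h : A.Alpha T B) : B.Alpha T A :=
  (ERaw.Alpha.euclid_trans A).1 _ _ h (ERaw.Alpha.refl A)

theorem ERaw.Alpha.trans {A B C : ERaw Pred Act κ} (h : A.Alpha T B) (h' : B.Alpha T C) :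
    A.Alpha T C := (ERaw.Alpha.euclid_trans A).2 _ _ h h'

end AlphaLemmas

/-! ### Hereditarily finitely supported expressions -/

/-- The class `p` of `x` has finite support. -/
def ClassFS (𝒩 : Type u) [NameSet 𝒩] {X : Type*} [MulAction (NPerm 𝒩) X] (p : X → Prop) (x : X) :
    Prop :=
  ∃ N : Set 𝒩, N.Finite ∧ ClassSupports 𝒩 p x N

/-- Every conjunction occurring in the formula has a finitely supported set of conjuncts (up to
alpha-equivalence). The other constructors preserve finite support. -/
def Raw.Hfs (T : NTS 𝒩 State Pred Act) : Raw Pred Act κ → Prop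
  | .conj ι h f => ClassFS 𝒩 ((Raw.conj ι h f).Alpha T) (.conj ι h f) ∧ ∀ i, (f i).Hfs T
  | .neg A => A.Hfs T
  | .pred _ => True
  | .may _ A => A.Hfs T

mutual
/-- Every conjunction and disjunction in the expression is over a finitely supported set. -/
def ERaw.Hfs (T : NTS 𝒩 State Pred Act) : ERaw Pred Act κ → Prop
  | .conj ι h f => ClassFS 𝒩 ((ERaw.conj ι h f).Alpha T) (.conj ι h f) ∧ ∀ i, (f i).Hfs T
  | .neg E => E.Hfs T
  | .wmay _ E => E.Hfs T
  | .wtau B => B.Hfs T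
/-- Every conjunction and disjunction in the expression is over a finitely supported set. -/
def BRaw.Hfs (T : NTS 𝒩 State Pred Act) : BRaw Pred Act κ → Prop
  | .and E B => E.Hfs T ∧ B.Hfs T
  | .pred _ => True
  | .disj ι h f => ClassFS 𝒩 ((BRaw.disj ι h f).Alpha T) (.disj ι h f) ∧ ∀ i, (f i).Hfs T
end

section HfsLemmas

variable {T : NTS 𝒩 State Pred Act} {X : Type*} [MulAction (NPerm 𝒩) X]

theorem ClassSupports.smul {r : X → X → Prop}
    (hr : ∀ (π : NPerm 𝒩) y z, r y z → r (π • y) (π • z)) {x : X} {N : Set 𝒩}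
    (hs : ClassSupports 𝒩 (r x) x N) (π : NPerm 𝒩) :
    ClassSupports 𝒩 (r (π • x)) (π • x) (π • N) := by
  intro ρ hρ
  have := hr π _ _ (hs (π⁻¹ * ρ * π) (fun b hb => by
    have := hρ _ (Set.smul_mem_smul_set hb)
    rw [mul_smul, mul_smul, this, inv_smul_smul]))
  rwa [mul_smul, mul_smul, smul_inv_smul] at this

theorem ClassFS.smul {r : X → X → Prop}
    (hr : ∀ (π : NPerm 𝒩) y z, r y z → r (π • y) (π • z)) {x : X}
    (h : ClassFS 𝒩 (r x) x) (π : NPerm 𝒩) : ClassFS 𝒩 (r (π • x)) (π • x) := by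
  obtain ⟨N, hN, hs⟩ := h
  exact ⟨π • N, hN.image _, hs.smul hr π⟩

/-- The permutation swapping two names of the same sort. -/
noncomputable def nswap (a b : 𝒩) (h : NameSet.sort b = NameSet.sort a) : NPerm 𝒩 := by
  classical
  refine ⟨Equiv.swap a b, fun c => ?_, ((Set.finite_singleton b).insert a).subset fun c hc => ?_⟩
  · rw [Equiv.swap_apply_def]
    split_ifs with h1 h2
    · rw [h, h1]
    · rw [h2, h]
    · rfl
  · by_contra hn
    simp only [Set.mem_insert_iff, Set.mem_singleton_iff, not_or] at hn
    exact hc (Equiv.swap_apply_of_ne_of_ne hn.1 hn.2)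

theorem nswap_smul_left (a b : 𝒩) (h) : nswap a b h • a = b := by
  classical
  change Equiv.swap a b a = b
  simp

theorem nswap_smul_of_ne (a b : 𝒩) (h) {c : 𝒩} (h1 : c ≠ a) (h2 : c ≠ b) :
    nswap a b h • c = c := by
  classical
  exact Equiv.swap_apply_of_ne_of_ne h1 h2

/-- The support of a class is a support of the class, or all of `𝒩`. -/
theorem classSupp_spec {r : X → X → Prop}
    (hr : ∀ (π : NPerm 𝒩) y z, r y z → r (π • y) (π • z)) (hrefl : ∀ x, r x x)
    (hsymm : ∀ x y, r x y → r y x) (htrans : ∀ x y z, r x y → r y z → r x z) (x : X) :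
    ClassSupports 𝒩 (r x) x (classSupp 𝒩 (r x) x) := by
  by_cases hfs : ∃ N : Finset 𝒩, ClassSupports 𝒩 (r x) x N
  · classical
    have key : ∀ (N M : Finset 𝒩) (a : 𝒩), ClassSupports 𝒩 (r x) x N →
        ClassSupports 𝒩 (r x) x M → a ∉ M → ClassSupports 𝒩 (r x) x (N.erase a : Finset 𝒩) := by
      intro N M a hN hM ha π hπ
      have hfin : (((N ∪ M ∪ {a} : Finset 𝒩) : Set 𝒩) ∪ {b | π.1 b ≠ b}).Finite :=
        (Finset.finite_toSet _).union π.2.2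
      obtain ⟨c, hc, hc'⟩ := ((NameSet.infinite_sort a).sdiff hfin).nonempty
      simp only [Set.mem_union, Finset.mem_coe, Finset.mem_union, Finset.mem_singleton,
        not_or] at hc'
      have hs : r x (nswap a c hc • x) := hM _ fun b hb => nswap_smul_of_ne _ _ _
        (fun h => ha (by rw [← h]; exact hb)) (fun h => hc'.1.1.2 (by rw [← h]; exact hb))
      have hN' := hN.smul hr (nswap a c hc) π (by
        rintro _ ⟨b, hb, rfl⟩
        by_cases hba : b = a
        · subst hba
          change π • (nswap b c hc • b) = nswap b c hc • b
          rw [nswap_smul_left]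
          by_contra hn
          exact hc'.2 hn
        · change π • (nswap a c hc • b) = nswap a c hc • b
          rw [nswap_smul_of_ne _ _ _ hba (fun h => hc'.1.1.1 (by rw [← h]; exact hb))]
          exact hπ b (by simp [hba]; exact hb))
      exact htrans _ _ _ (htrans _ _ _ hs hN') (hsymm _ _ (hr π _ _ hs))
    obtain ⟨N, hN, hmin⟩ : ∃ N : Finset 𝒩, ClassSupports 𝒩 (r x) x N ∧
        ∀ M : Finset 𝒩, ClassSupports 𝒩 (r x) x M → N.card ≤ M.card := by
      obtain ⟨N, hN⟩ := hfs
      obtain ⟨N, hN, h⟩ := WellFounded.has_min (measure (Finset.card (α := 𝒩))).wf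
        {N : Finset 𝒩 | ClassSupports 𝒩 (r x) x N} ⟨N, hN⟩
      exact ⟨N, hN, fun M hM => not_lt.1 (h M hM)⟩
    have : (N : Set 𝒩) ⊆ classSupp 𝒩 (r x) x := by
      rintro a ha M ⟨hM, hs⟩
      by_contra hc
      have := hmin _ (key N hM.toFinset a hN (by simpa using hs) (by simpa using hc))
      exact absurd this (not_le.2 (Finset.card_erase_lt_of_mem ha))
    exact fun π hπ => hN π fun a ha => hπ a (this ha)
  · intro π hπ
    have : π = 1 := by
      apply Subtype.ext
      ext a
      refine hπ a ?_
      rintro M ⟨hM, hs⟩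
      exact absurd ⟨hM.toFinset, by simpa using hs⟩ hfs
    rw [this, one_smul]
    exact hrefl x

theorem Raw.Hfs.smul (π : NPerm 𝒩) : ∀ {A : Raw Pred Act κ}, A.Hfs T → (π • A).Hfs T
  | .conj ι h f, hA => by
    rw [Raw.Hfs] at hA
    rw [Raw.smul_conj, Raw.Hfs]
    refine ⟨?_, fun i => Raw.Hfs.smul π (hA.2 i)⟩
    rw [← Raw.smul_conj]
    exact hA.1.smul (fun π y z => Raw.Alpha.smul π z) π
  | .neg A, hA => by
    rw [Raw.Hfs] at hA
    rw [Raw.smul_neg, Raw.Hfs]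
    exact Raw.Hfs.smul π hA
  | .pred φ, hA => by rw [Raw.smul_pred, Raw.Hfs]; trivial
  | .may α A, hA => by
    rw [Raw.Hfs] at hA
    rw [Raw.smul_may, Raw.Hfs]
    exact Raw.Hfs.smul π hA

mutual
theorem ERaw.Hfs.smul (π : NPerm 𝒩) : ∀ {A : ERaw Pred Act κ}, A.Hfs T → (π • A).Hfs T
  | .conj ι h f, hA => by
    rw [ERaw.Hfs] at hA
    rw [ERaw.smul_conj, ERaw.Hfs]
    refine ⟨?_, fun i => ERaw.Hfs.smul π (hA.2 i)⟩
    rw [← ERaw.smul_conj]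
    exact hA.1.smul (fun π y z => ERaw.Alpha.smul π z) π
  | .neg A, hA => by
    rw [ERaw.Hfs] at hA
    rw [ERaw.smul_neg, ERaw.Hfs]
    exact ERaw.Hfs.smul π hA
  | .wmay α A, hA => by
    rw [ERaw.Hfs] at hA
    rw [ERaw.smul_wmay, ERaw.Hfs]
    exact ERaw.Hfs.smul π hA
  | .wtau A, hA => by
    rw [ERaw.Hfs] at hA
    rw [ERaw.smul_wtau, ERaw.Hfs]
    exact BRaw.Hfs.smul π hA
theorem BRaw.Hfs.smul (π : NPerm 𝒩) : ∀ {A : BRaw Pred Act κ}, A.Hfs T → (π • A).Hfs T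
  | .and E B, hA => by
    rw [BRaw.Hfs] at hA
    rw [BRaw.smul_and, BRaw.Hfs]
    exact ⟨ERaw.Hfs.smul π hA.1, BRaw.Hfs.smul π hA.2⟩
  | .pred φ, hA => by rw [BRaw.smul_pred, BRaw.Hfs]; trivial
  | .disj ι h f, hA => by
    rw [BRaw.Hfs] at hA
    rw [BRaw.smul_disj, BRaw.Hfs]
    refine ⟨?_, fun i => BRaw.Hfs.smul π (hA.2 i)⟩
    rw [← BRaw.smul_disj]
    exact hA.1.smul (fun π y z => BRaw.Alpha.smul π z) π
end

end HfsLemmas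

/-! ### Validity -/

/-- Validity of raw formulas. In the last clause, `⟨π • α⟩ (π • A)` ranges over the alpha-variants of
`⟨α⟩ A`; by equivariance of validity, `π⁻¹ • P' ⊨ A` says that `P' ⊨ π • A`
(see `Raw.sat_may_iff`). -/
def Raw.Sat (T : NTS 𝒩 State Pred Act) : Raw Pred Act κ → State → Prop
  | .conj _ _ f, P => ∀ i, (f i).Sat T P
  | .neg A, P => ¬ A.Sat T P
  | .pred φ, P => T.entails P φ
  | .may α A, P => ∃ π : NPerm 𝒩,
      (∀ a ∈ (supp 𝒩 α ∪ classSupp 𝒩 (A.Alpha T) A) \ (T.bn α : Set 𝒩), π • a = a) ∧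
      Disjoint (T.bn (π • α) : Set 𝒩) (supp 𝒩 P) ∧
      ∃ P', T.Step P (π • α) P' ∧ A.Sat T (π⁻¹ • P')

section SatLemmas

variable {T : NTS 𝒩 State Pred Act}

theorem Raw.classSupp_smul (π : NPerm 𝒩) (A : Raw Pred Act κ) :
    classSupp 𝒩 ((π • A).Alpha T) (π • A) = π • classSupp 𝒩 (A.Alpha T) A :=
  NominalHML.classSupp_smul (fun π _ z => Raw.Alpha.smul π z) π A

theorem Raw.Alpha.classSupp_eq {A B : Raw Pred Act κ} (h : A.Alpha T B) :
    classSupp 𝒩 (A.Alpha T) A = classSupp 𝒩 (B.Alpha T) B :=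
  classSupp_congr (fun π _ z => Raw.Alpha.smul π z) (Raw.Alpha.refl A)
    (fun _ _ h h' => h.symm.trans h') (fun _ _ h h' => h.trans h') h

theorem Raw.sat_may_smul (ρ : NPerm 𝒩) {α : Act} {A : Raw Pred Act κ} {P : State}
    (ih : ∀ Q, A.Sat T Q → (ρ • A).Sat T (ρ • Q)) (h : (Raw.may α A).Sat T P) :
    (Raw.may (ρ • α) (ρ • A)).Sat T (ρ • P) := by
  rw [Raw.Sat] at h ⊢
  obtain ⟨π, h1, h2, P', h3, h4⟩ := h
  have e : (ρ * π * ρ⁻¹) • ρ • α = ρ • π • α := by simp [mul_smul]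
  refine ⟨ρ * π * ρ⁻¹, ?_, ?_, ρ • P', ?_, ?_⟩
  · rintro a ⟨ha, hb⟩
    rw [Raw.classSupp_smul, supp_smul, ← Set.smul_set_union,
      Set.mem_smul_set_iff_inv_smul_mem] at ha
    rw [T.bn_smul, Set.mem_smul_set_iff_inv_smul_mem] at hb
    rw [mul_smul, mul_smul, h1 _ ⟨ha, hb⟩, smul_inv_smul]
  · rw [e, T.bn_smul, supp_smul]
    exact Set.disjoint_smul_set.2 h2
  · rw [e]
    exact T.trans_smul ρ _ _ _ h3
  · have := ih _ h4
    simpa [mul_smul] using this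

theorem Raw.sat_smul : ∀ (A : Raw Pred Act κ) (ρ : NPerm 𝒩) (P : State),
    (ρ • A).Sat T (ρ • P) ↔ A.Sat T P
  | .conj _ _ f, ρ, P => by
    rw [Raw.smul_conj, Raw.Sat, Raw.Sat]
    exact forall_congr' fun i => Raw.sat_smul (f i) ρ P
  | .neg A, ρ, P => by
    rw [Raw.smul_neg, Raw.Sat, Raw.Sat]
    exact not_congr (Raw.sat_smul A ρ P)
  | .pred φ, ρ, P => by
    rw [Raw.smul_pred, Raw.Sat, Raw.Sat]
    refine ⟨fun h => ?_, T.entails_smul ρ _ _⟩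
    simpa using T.entails_smul ρ⁻¹ _ _ h
  | .may α A, ρ, P => by
    rw [Raw.smul_may]
    refine ⟨fun h => ?_, Raw.sat_may_smul ρ fun Q => (Raw.sat_smul A ρ Q).2⟩
    have := Raw.sat_may_smul ρ⁻¹ (fun Q hQ => by
      rw [inv_smul_smul, ← Raw.sat_smul A ρ, smul_inv_smul]
      exact hQ) h
    simpa using this

theorem Raw.Alpha.sat_iff : ∀ {A B : Raw Pred Act κ}, A.Alpha T B →
    ∀ P, A.Sat T P ↔ B.Sat T P
  | .conj _ _ f, B, h, P => by
    cases B <;> simp only [Raw.Alpha] at h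
    rw [Raw.Sat, Raw.Sat]
    refine ⟨fun k j => ?_, fun k i => ?_⟩
    · obtain ⟨i, hi⟩ := h.2 j
      exact (Raw.Alpha.sat_iff hi P).1 (k i)
    · obtain ⟨j, hj⟩ := h.1 i
      exact (Raw.Alpha.sat_iff hj P).2 (k j)
  | .neg A, B, h, P => by
    cases B <;> simp only [Raw.Alpha] at h
    rw [Raw.Sat, Raw.Sat]
    exact not_congr (Raw.Alpha.sat_iff h P)
  | .pred φ, B, h, P => by
    cases B <;> simp only [Raw.Alpha] at h
    rw [h]
  | .may α A, B, h, P => by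
    cases B <;> simp only [Raw.Alpha] at h
    rename_i β B
    obtain ⟨σ, h1, h2, h3⟩ := h
    have ih := Raw.Alpha.sat_iff h2
    have hs : classSupp 𝒩 (B.Alpha T) B = σ • classSupp 𝒩 (A.Alpha T) A := by
      rw [h2.classSupp_eq, ← Raw.classSupp_smul, smul_inv_smul]
    rw [Raw.Sat, Raw.Sat, hs, ← h1, supp_smul, ← Set.smul_set_union]
    constructor
    · rintro ⟨π, k1, k2, P', k3, k4⟩
      refine ⟨π * σ⁻¹, ?_, by simpa [mul_smul] using k2, P', by simpa [mul_smul] using k3, ?_⟩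
      · rintro a ⟨ha, hb⟩
        rw [Set.mem_smul_set_iff_inv_smul_mem] at ha
        rw [T.bn_smul, Set.mem_smul_set_iff_inv_smul_mem] at hb
        have e1 := h3 _ ⟨ha, hb⟩
        have e2 := k1 _ ⟨ha, hb⟩
        rw [smul_inv_smul] at e1
        rw [mul_smul, e2, ← e1]
      · have := (Raw.sat_smul _ σ _).2 ((ih _).1 k4)
        simpa [mul_smul] using this
    · rintro ⟨π, k1, k2, P', k3, k4⟩
      refine ⟨π * σ, ?_, by simpa [mul_smul] using k2, P', by simpa [mul_smul] using k3, ?_⟩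
      · rintro a ⟨ha, hb⟩
        have e1 := h3 _ ⟨ha, hb⟩
        rw [mul_smul, e1]
        refine k1 a ⟨?_, ?_⟩
        · rw [← e1]
          exact Set.smul_mem_smul_set ha
        · rw [T.bn_smul, ← e1, Set.smul_mem_smul_set_iff]
          exact hb
      · rw [ih]
        have := (Raw.sat_smul _ σ⁻¹ _).2 k4
        simpa [mul_smul] using this

/-- `⟨α⟩ A` holds in `P` iff for some alpha-variant `⟨β⟩ B` with `bn β # P` there is a
transition `P --β--> P'` with `P' ⊨ B`. -/
theorem Raw.sat_may_iff (α : Act) (A : Raw Pred Act κ) (P : State) :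
    (Raw.may α A).Sat T P ↔ ∃ β B P', (Raw.may α A).Alpha T (Raw.may β B) ∧
      Disjoint (T.bn β : Set 𝒩) (supp 𝒩 P) ∧ T.Step P β P' ∧ B.Sat T P' := by
  rw [Raw.Sat]
  constructor
  · rintro ⟨π, h1, h2, P', h3, h4⟩
    refine ⟨π • α, π • A, P', ?_, h2, h3, ?_⟩
    · rw [Raw.Alpha]
      exact ⟨π, rfl, by rw [inv_smul_smul]; exact Raw.Alpha.refl A, h1⟩
    · rw [← Raw.sat_smul A π, smul_inv_smul] at h4
      exact h4
  · rintro ⟨β, B, P', h, h2, h3, h4⟩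
    rw [Raw.Alpha] at h
    obtain ⟨σ, k1, k2, k3⟩ := h
    subst k1
    refine ⟨σ, k3, h2, P', h3, ?_⟩
    rw [k2.sat_iff]
    exact (Raw.sat_smul B σ⁻¹ P').2 h4

end SatLemmas

/-! ### Derived operators on raw formulas -/

/-- The disjunction `⋁ Aᵢ`, that is `¬ ⋀ ¬ Aᵢ`. -/
def Raw.disj (ι : Type u) (hι : #ι < κ) (f : ι → Raw Pred Act κ) : Raw Pred Act κ :=
  .neg (.conj ι hι fun i => .neg (f i))

section

variable {T : NTS 𝒩 State Pred Act}

theorem Raw.smul_disj (π : NPerm 𝒩) (ι : Type u) (hι : #ι < κ) (f : ι → Raw Pred Act κ) :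
    π • Raw.disj ι hι f = Raw.disj ι hι fun i => π • f i := rfl

theorem Raw.smul_iterate_tau (π : NPerm 𝒩) (n : ℕ) (A : Raw Pred Act κ) :
    π • (Raw.may T.tau)^[n] A = (Raw.may T.tau)^[n] (π • A) := by
  induction n with
  | zero => rfl
  | succ n ih => rw [Function.iterate_succ_apply', Raw.smul_may, ih, T.tau_smul,
      Function.iterate_succ_apply']

theorem Raw.Alpha.disj {ι ι' : Type u} {hι : #ι < κ} {hι' : #ι' < κ} {f : ι → Raw Pred Act κ}
    {g : ι' → Raw Pred Act κ} (h : SameSet (fun i => (f i).Alpha T) g) :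
    (Raw.disj ι hι f).Alpha T (.disj ι' hι' g) := by
  unfold Raw.disj
  rw [Raw.Alpha, Raw.Alpha]
  exact h.map fun i j h => by rw [Raw.Alpha]; exact h

theorem Raw.Alpha.may {A B : Raw Pred Act κ} (h : A.Alpha T B) (α : Act) :
    (Raw.may α A).Alpha T (.may α B) := by
  rw [Raw.Alpha]
  exact ⟨1, by simp, by simpa using h, by simp⟩

theorem Raw.Alpha.iterate_may {A B : Raw Pred Act κ} (h : A.Alpha T B) (α : Act) (n : ℕ) :
    ((Raw.may α)^[n] A).Alpha T ((Raw.may α)^[n] B) := by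
  induction n with
  | zero => exact h
  | succ n ih =>
    rw [Function.iterate_succ_apply', Function.iterate_succ_apply']
    exact ih.may α

theorem NTS.bn_tau : (T.bn T.tau : Set 𝒩) = ∅ :=
  Set.subset_empty_iff.1 ((T.bn_subset T.tau).trans fun _ ha =>
    ha ∅ ⟨Set.finite_empty, fun π _ => T.tau_smul π⟩)

theorem Raw.Hfs.classFS : ∀ {A : Raw Pred Act κ}, A.Hfs T → ClassFS 𝒩 (A.Alpha T) A
  | .conj ι h f, hA => by rw [Raw.Hfs] at hA; exact hA.1
  | .neg A, hA => by
    rw [Raw.Hfs] at hA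
    obtain ⟨N, hN, hs⟩ := Raw.Hfs.classFS hA
    refine ⟨N, hN, fun π hπ => ?_⟩
    rw [Raw.smul_neg, Raw.Alpha]
    exact hs π hπ
  | .pred φ, _ => by
    obtain ⟨N, hN, hs⟩ := Nominal.exists_support (𝒩 := 𝒩) φ
    refine ⟨N, hN, fun π hπ => ?_⟩
    rw [Raw.smul_pred, Raw.Alpha]
    exact (hs π fun a ha => hπ a ha).symm
  | .may α A, hA => by
    rw [Raw.Hfs] at hA
    obtain ⟨N, hN, hs⟩ := Raw.Hfs.classFS hA
    obtain ⟨M, hM, ht⟩ := Nominal.exists_support (𝒩 := 𝒩) α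
    refine ⟨N ∪ M, hN.union hM, fun π hπ => ?_⟩
    rw [Raw.smul_may, ht π fun a ha => hπ a (Or.inr ha)]
    exact (hs π fun a ha => hπ a (Or.inl ha)).may α

theorem Raw.Hfs.disj {ι : Type u} {hι : #ι < κ} {f : ι → Raw Pred Act κ}
    (h : ClassFS 𝒩 ((Raw.disj ι hι f).Alpha T) (.disj ι hι f)) (hf : ∀ i, (f i).Hfs T) :
    (Raw.disj ι hι f).Hfs T := by
  obtain ⟨N, hN, hs⟩ := h
  unfold Raw.disj at hs ⊢
  rw [Raw.Hfs, Raw.Hfs]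
  refine ⟨⟨N, hN, fun π hπ => ?_⟩, fun i => by rw [Raw.Hfs]; exact hf i⟩
  have := hs π hπ
  rw [Raw.smul_neg, Raw.Alpha] at this
  exact this

end

section Derived

variable [hκ : Fact (ℵ₀ < κ)]

theorem card_lt_of_countable (ι : Type u) [Countable ι] : #ι < κ :=
  (Cardinal.mk_le_aleph0_iff.2 inferInstance).trans_lt hκ.out

/-- `⊤` is the empty conjunction. -/
def Raw.top : Raw Pred Act κ := .conj PEmpty (card_lt_of_countable _) PEmpty.elim

/-- The binary conjunction `A ∧ B`. -/
def Raw.and (A B : Raw Pred Act κ) : Raw Pred Act κ :=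
  .conj (ULift Bool) (card_lt_of_countable _) fun b => cond b.down A B

variable (T : NTS 𝒩 State Pred Act)

/-- `⟪τ⟫ A` is the disjunction of all `⟨τ⟩ⁱ A`. -/
def Raw.wtau (A : Raw Pred Act κ) : Raw Pred Act κ :=
  .disj (ULift ℕ) (card_lt_of_countable _) fun i => (Raw.may T.tau)^[i.down] A

open Classical in
/-- The weak action modality: `⟪α⟫ A` is `⟪τ⟫ ⟨α⟩ ⟪τ⟫ A` for `α ≠ τ`. -/
noncomputable def Raw.wmay (α : Act) (A : Raw Pred Act κ) : Raw Pred Act κ :=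
  if α = T.tau then A.wtau T else ((A.wtau T).may α).wtau T

/-- Weak formulas: `A ::= ⋀ Aᵢ | ¬ A | ⟪α⟫ A | ⟪τ⟫ (A ∧ φ)`. -/
inductive Raw.Weak : Raw Pred Act κ → Prop
  | conj (ι : Type u) (hι : #ι < κ) (f : ι → Raw Pred Act κ) :
      (∀ i, Raw.Weak (f i)) → Raw.Weak (.conj ι hι f)
  | neg (A : Raw Pred Act κ) : Raw.Weak A → Raw.Weak (.neg A)
  | wmay (α : Act) (A : Raw Pred Act κ) : Raw.Weak A → Raw.Weak (A.wmay T α)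
  | wtau_and (A : Raw Pred Act κ) (φ : Pred) : Raw.Weak A →
      Raw.Weak ((A.and (.pred φ)).wtau T)

mutual
/-- The formula that an extended weak expression stands for. -/
noncomputable def ERaw.interp : ERaw Pred Act κ → Raw Pred Act κ
  | .conj ι h f => .conj ι h fun i => (f i).interp
  | .neg E => .neg E.interp
  | .wmay α E => E.interp.wmay T α
  | .wtau B => B.interp.wtau T
/-- The formula that a preformula expression stands for. -/
noncomputable def BRaw.interp : BRaw Pred Act κ → Raw Pred Act κ
  | .and E B => E.interp.and B.interp
  | .pred φ => .pred φ
  | .disj ι h f => .disj ι h fun i => (f i).interp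
end

/-! ### The normalisation -/

/-- `δ(A ∧ φ) = ⟪τ⟫(A ∧ φ)` and `δ(⋁ Cᵢ) = ⋁ δ(Cᵢ)`. -/
def NRaw.delta : NRaw Pred Act κ → Raw Pred Act κ
  | .leaf A φ => (A.and (.pred φ)).wtau T
  | .disj ι h f => .disj ι h fun i => (f i).delta

/-- `ε(A, A' ∧ φ) = (A ∧ A') ∧ φ` and `ε(A, ⋁ Cᵢ) = ⋁ ε(A, Cᵢ)`. -/
def NRaw.eps (A : Raw Pred Act κ) : NRaw Pred Act κ → NRaw Pred Act κ
  | .leaf A' φ => .leaf (A.and A') φ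
  | .disj ι h f => .disj ι h fun i => (f i).eps A

mutual
/-- The normalisation `Δ` of extended weak expressions. -/
noncomputable def ERaw.normalise : ERaw Pred Act κ → Raw Pred Act κ
  | .conj ι h f => .conj ι h fun i => (f i).normalise
  | .neg E => .neg E.normalise
  | .wmay α E => E.normalise.wmay T α
  | .wtau B => B.normalise.delta T
/-- The normalisation `Δ_pre` of preformula expressions. -/
noncomputable def BRaw.normalise : BRaw Pred Act κ → NRaw Pred Act κ
  | .and E B => B.normalise.eps E.normalise
  | .pred φ => .leaf .top φ
  | .disj ι h f => .disj ι h fun i => (f i).normalise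
end

variable {T}

/-! Well-definedness of the interpretation. -/

theorem Raw.smul_and (π : NPerm 𝒩) (A B : Raw Pred Act κ) :
    π • A.and B = (π • A).and (π • B) := by
  simp only [Raw.and, Raw.smul_conj]
  congr 1
  funext b
  cases b.down <;> rfl

theorem Raw.smul_wtau (π : NPerm 𝒩) (A : Raw Pred Act κ) :
    π • A.wtau T = (π • A).wtau T := by
  simp only [Raw.wtau, Raw.smul_disj, Raw.smul_iterate_tau]

theorem Raw.smul_wmay (π : NPerm 𝒩) (α : Act) (A : Raw Pred Act κ) :
    π • A.wmay T α = (π • A).wmay T (π • α) := by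
  have : π • α = T.tau ↔ α = T.tau := by
    rw [smul_eq_iff_eq_inv_smul, T.tau_smul]
  unfold Raw.wmay
  by_cases h : α = T.tau
  · rw [if_pos h, if_pos (this.2 h), Raw.smul_wtau]
  · rw [if_neg h, if_neg (mt this.1 h), Raw.smul_wtau, Raw.smul_may, Raw.smul_wtau]

mutual
theorem ERaw.interp_smul (π : NPerm 𝒩) :
    ∀ E : ERaw Pred Act κ, (π • E).interp T = π • E.interp T
  | .conj ι h f => by
    simp [ERaw.interp, fun i => ERaw.interp_smul π (f i)]
  | .neg E => by simp [ERaw.interp, ERaw.interp_smul π E]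
  | .wmay α E => by simp [ERaw.interp, ERaw.interp_smul π E, Raw.smul_wmay]
  | .wtau B => by simp [ERaw.interp, BRaw.interp_smul π B, Raw.smul_wtau]
theorem BRaw.interp_smul (π : NPerm 𝒩) :
    ∀ B : BRaw Pred Act κ, (π • B).interp T = π • B.interp T
  | .and E B => by
    simp [BRaw.interp, ERaw.interp_smul π E, BRaw.interp_smul π B, Raw.smul_and]
  | .pred φ => by simp [BRaw.interp]
  | .disj ι h f => by
    simp [BRaw.interp, fun i => BRaw.interp_smul π (f i), Raw.smul_disj]
end

theorem Raw.Alpha.and {A B A' B' : Raw Pred Act κ} (h : A.Alpha T A') (h' : B.Alpha T B') :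
    (A.and B).Alpha T (A'.and B') := by
  unfold Raw.and
  rw [Raw.Alpha]
  refine ⟨fun b => ⟨b, ?_⟩, fun b => ⟨b, ?_⟩⟩ <;> rcases b with ⟨_ | _⟩ <;> assumption

theorem Raw.Alpha.wtau {A B : Raw Pred Act κ} (h : A.Alpha T B) :
    (A.wtau T).Alpha T (B.wtau T) :=
  Raw.Alpha.disj ⟨fun i => ⟨i, h.iterate_may _ _⟩, fun i => ⟨i, h.iterate_may _ _⟩⟩

theorem Raw.wmay_alpha {α β : Act} {A B : Raw Pred Act κ}
    (h : SameAbs T α (A.Alpha T) A β B) : (A.wmay T α).Alpha T (B.wmay T β) := by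
  unfold Raw.wmay
  by_cases hα : α = T.tau
  · subst hα
    obtain ⟨π, h1, h2, h3⟩ := h
    rw [T.tau_smul] at h1
    subst h1
    simp only [if_true]
    apply Raw.Alpha.wtau
    have h4 : A.Alpha T (π • A) := classSupp_spec (fun π _ z => Raw.Alpha.smul π z)
      Raw.Alpha.refl (fun _ _ => Raw.Alpha.symm) (fun _ _ _ => Raw.Alpha.trans) A π
      fun a ha => h3 a ⟨Or.inr ha, by simp [T.bn_tau]⟩
    have h5 := h2.smul π
    rw [smul_inv_smul] at h5
    exact h4.trans h5
  · have hβ : β ≠ T.tau := by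
      obtain ⟨π, h1, -⟩ := h
      rw [← h1, Ne, smul_eq_iff_eq_inv_smul, T.tau_smul]
      exact hα
    rw [if_neg hα, if_neg hβ]
    apply Raw.Alpha.wtau
    rw [Raw.Alpha]
    exact h.map (fun π x => (Raw.smul_wtau π x).symm) fun z hz => hz.wtau

mutual
theorem ERaw.Alpha.interp : ∀ {E E' : ERaw Pred Act κ}, E.Alpha T E' →
    (E.interp T).Alpha T (E'.interp T)
  | .conj _ _ f, B, h => by
    cases B <;> simp only [ERaw.Alpha] at h
    rw [ERaw.interp, ERaw.interp, Raw.Alpha]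
    exact h.map fun i j h => ERaw.Alpha.interp h
  | .neg A, B, h => by
    cases B <;> simp only [ERaw.Alpha] at h
    rw [ERaw.interp, ERaw.interp, Raw.Alpha]
    exact ERaw.Alpha.interp h
  | .wmay α A, B, h => by
    cases B <;> simp only [ERaw.Alpha] at h
    rw [ERaw.interp, ERaw.interp]
    exact Raw.wmay_alpha (h.map (fun π x => ERaw.interp_smul π x) fun z hz => ERaw.Alpha.interp hz)
  | .wtau A, B, h => by
    cases B <;> simp only [ERaw.Alpha] at h
    rw [ERaw.interp, ERaw.interp]
    exact (BRaw.Alpha.interp h).wtau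
theorem BRaw.Alpha.interp : ∀ {E E' : BRaw Pred Act κ}, E.Alpha T E' →
    (E.interp T).Alpha T (E'.interp T)
  | .and E A, B, h => by
    cases B <;> simp only [BRaw.Alpha] at h
    rw [BRaw.interp, BRaw.interp]
    exact (ERaw.Alpha.interp h.1).and (BRaw.Alpha.interp h.2)
  | .pred φ, B, h => by
    cases B <;> simp only [BRaw.Alpha] at h
    rw [BRaw.interp, BRaw.interp, Raw.Alpha]
    exact h
  | .disj _ _ f, B, h => by
    cases B <;> simp only [BRaw.Alpha] at h
    rw [BRaw.interp, BRaw.interp]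
    exact Raw.Alpha.disj (h.map fun i j h => BRaw.Alpha.interp h)
end

theorem Raw.Hfs.and {A B : Raw Pred Act κ} (hA : A.Hfs T) (hB : B.Hfs T) : (A.and B).Hfs T := by
  obtain ⟨N, hN, hs⟩ := hA.classFS
  obtain ⟨M, hM, ht⟩ := hB.classFS
  have key : ClassFS 𝒩 ((A.and B).Alpha T) (A.and B) := by
    refine ⟨N ∪ M, hN.union hM, fun π hπ => ?_⟩
    rw [Raw.smul_and]
    exact (hs π fun a ha => hπ a (Or.inl ha)).and (ht π fun a ha => hπ a (Or.inr ha))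
  unfold Raw.and at key ⊢
  rw [Raw.Hfs]
  refine ⟨key, fun b => ?_⟩
  rcases b with ⟨_ | _⟩ <;> assumption

theorem Raw.Hfs.wtau {A : Raw Pred Act κ} (hA : A.Hfs T) : (A.wtau T).Hfs T := by
  obtain ⟨N, hN, hs⟩ := hA.classFS
  refine Raw.Hfs.disj ⟨N, hN, fun π hπ => ?_⟩ fun i => ?_
  · have := (hs π hπ).wtau
    rw [← Raw.smul_wtau] at this
    exact this
  · induction i.down with
    | zero => exact hA
    | succ n ih =>
      rw [Function.iterate_succ_apply', Raw.Hfs]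
      exact ih

theorem Raw.Hfs.wmay {A : Raw Pred Act κ} (hA : A.Hfs T) (α : Act) : (A.wmay T α).Hfs T := by
  unfold Raw.wmay
  split_ifs
  · exact hA.wtau
  · refine Raw.Hfs.wtau ?_
    rw [Raw.Hfs]
    exact hA.wtau

mutual
theorem ERaw.Hfs.interp : ∀ {E : ERaw Pred Act κ}, E.Hfs T → (E.interp T).Hfs T
  | .conj ι h f, hE => by
    rw [ERaw.Hfs] at hE
    obtain ⟨⟨N, hN, hs⟩, h2⟩ := hE
    have key : ClassFS 𝒩 (((ERaw.conj ι h f).interp T).Alpha T) ((ERaw.conj ι h f).interp T) :=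
      ⟨N, hN, fun π hπ => by
        rw [← ERaw.interp_smul]
        exact (hs π hπ).interp⟩
    rw [ERaw.interp] at key ⊢
    rw [Raw.Hfs]
    exact ⟨key, fun i => (h2 i).interp⟩
  | .neg E, hE => by
    rw [ERaw.Hfs] at hE
    rw [ERaw.interp, Raw.Hfs]
    exact hE.interp
  | .wmay α E, hE => by
    rw [ERaw.Hfs] at hE
    rw [ERaw.interp]
    exact (ERaw.Hfs.interp hE).wmay α
  | .wtau B, hE => by
    rw [ERaw.Hfs] at hE
    rw [ERaw.interp]
    exact (BRaw.Hfs.interp hE).wtau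
theorem BRaw.Hfs.interp : ∀ {B : BRaw Pred Act κ}, B.Hfs T → (B.interp T).Hfs T
  | .and E B, hE => by
    rw [BRaw.Hfs] at hE
    rw [BRaw.interp]
    exact (ERaw.Hfs.interp hE.1).and (BRaw.Hfs.interp hE.2)
  | .pred φ, _ => by rw [BRaw.interp, Raw.Hfs]; trivial
  | .disj ι h f, hE => by
    rw [BRaw.Hfs] at hE
    obtain ⟨⟨N, hN, hs⟩, h2⟩ := hE
    have key : ClassFS 𝒩 (((BRaw.disj ι h f).interp T).Alpha T) ((BRaw.disj ι h f).interp T) :=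
      ⟨N, hN, fun π hπ => by
        rw [← BRaw.interp_smul]
        exact (hs π hπ).interp⟩
    rw [BRaw.interp] at key ⊢
    exact Raw.Hfs.disj key fun i => (h2 i).interp
end

end Derived

/-! ### Formulas and extended weak formulas -/

section Formulas

variable (T : NTS 𝒩 State Pred Act) (κ)

/-- Alpha-equivalence of hereditarily finitely supported raw formulas. -/
def Raw.setoid : Setoid {A : Raw Pred Act κ // A.Hfs T} where
  r A B := A.1.Alpha T B.1
  iseqv := ⟨fun A => Raw.Alpha.refl A.1, Raw.Alpha.symm, Raw.Alpha.trans⟩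

/-- Alpha-equivalence of hereditarily finitely supported extended weak expressions. -/
def ERaw.setoid : Setoid {A : ERaw Pred Act κ // A.Hfs T} where
  r A B := A.1.Alpha T B.1
  iseqv := ⟨fun A => ERaw.Alpha.refl A.1, ERaw.Alpha.symm, ERaw.Alpha.trans⟩

/-- The nominal set of formulas `A ::= ⋀ Aᵢ | ¬ A | φ | ⟨α⟩ A`. -/
def Formula : Type (u + 1) := Quotient (Raw.setoid κ T)

/-- The nominal set of extended weak formulas, as expressions generated by the mutual grammar of
extended weak formulas and preformulas. -/
def EFormula : Type (u + 1) := Quotient (ERaw.setoid κ T)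

variable {T κ}

/-- The formula represented by a raw formula. -/
def Formula.mk (A : Raw Pred Act κ) (hA : A.Hfs T) : Formula κ T :=
  Quotient.mk (Raw.setoid κ T) ⟨A, hA⟩

/-- The extended weak formula represented by a raw expression. -/
def EFormula.mk (E : ERaw Pred Act κ) (hE : E.Hfs T) : EFormula κ T :=
  Quotient.mk (ERaw.setoid κ T) ⟨E, hE⟩

instance : SMul (NPerm 𝒩) (Formula κ T) where
  smul π := Quotient.map (sa := Raw.setoid κ T) (sb := Raw.setoid κ T)
    (fun A => ⟨π • A.1, A.2.smul π⟩) fun _ _ h => Raw.Alpha.smul π _ h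

instance : SMul (NPerm 𝒩) (EFormula κ T) where
  smul π := Quotient.map (sa := ERaw.setoid κ T) (sb := ERaw.setoid κ T)
    (fun A => ⟨π • A.1, A.2.smul π⟩) fun _ _ h => ERaw.Alpha.smul π _ h

/-- Validity `P ⊨ A`. -/
def Formula.Valid (P : State) : Formula κ T → Prop :=
  Quotient.lift (s := Raw.setoid κ T) (fun A => A.1.Sat T P)
    fun _ _ h => propext (Raw.Alpha.sat_iff h P)

/-- Logical equivalence of formulas: they are valid in the same states. -/
def Formula.Equivalent (A B : Formula κ T) : Prop :=
  ∀ P : State, A.Valid P ↔ B.Valid P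

variable [Fact (ℵ₀ < κ)]

/-- The weak formulas, as a sublogic of the formulas. -/
def Formula.IsWeak (A : Formula κ T) : Prop :=
  ∃ (R : Raw Pred Act κ) (hR : R.Hfs T), R.Weak T ∧ A = .mk R hR

/-- The extended weak formulas, as a sublogic of the formulas: formulas that have a parse by the
mutual grammar of extended weak formulas and preformulas. -/
def Formula.IsExtendedWeak (A : Formula κ T) : Prop :=
  ∃ (E : ERaw Pred Act κ) (hE : (E.interp T).Hfs T), A = .mk (E.interp T) hE

/-- The formula that an extended weak formula stands for. -/
noncomputable def EFormula.toFormula : EFormula κ T → Formula κ T :=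
  Quotient.map (sa := ERaw.setoid κ T) (sb := Raw.setoid κ T)
    (fun E => ⟨E.1.interp T, E.2.interp⟩) fun _ _ h => ERaw.Alpha.interp h

end Formulas

end NominalHML

namespace NominalHML

variable {𝒩 State Pred Act : Type u} [NameSet 𝒩] [Nominal 𝒩 State] [Nominal 𝒩 Pred]
  [Nominal 𝒩 Act] {κ : Cardinal.{u}}

/-! ### Supports and fresh renamings -/

section Fresh

-- The mathematical content is that `⟪τ⟫` and conjunction with a fixed formula both distribute over
-- disjunction. A preformula is a disjunction tree whose leaves are state predicates guarded by
-- conjunctions. `ε` pushes the guards down to the leaves, which gives a normal preformula, and `δ`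
-- then pushes `⟪τ⟫` down to them, where it meets `A ∧ φ` and yields the last production of the weak
-- grammar. Semantically these are `NRaw.sat_eps_iff` and `NRaw.sat_delta_iff`: `⟪τ⟫` quantifies
-- existentially over τ-descendants, and existentials commute. The equivalence of `E` and `Δ(E)`
-- follows by mutual induction (`ERaw.Hfs.sat_normalise_iff`).
--
-- The induction has one delicate case, the binder `⟨α⟩`. The alpha-variants of `⟨α⟩A` depend on the
-- support of `A`, and `E` and `Δ(E)` may have different supports. `Raw.sat_may_mono` shows that
-- validity does not see this: the bound names can be renamed away from both supports at once, in
-- the formula and in the transition.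
--
-- Well-definedness rests on one principle: a map that is equivariant and respects alpha-equivalence
-- cannot enlarge supports. The maps `ε`, `δ`, `Δ` and `Δ_pre` are shown to be such maps, so all
-- conjunctions and disjunctions they produce are finitely supported.
--
-- For the last claim, a parse of a finitely supported formula may itself fail to be finitely
-- supported, since parses of the conjuncts are chosen without regard to names.
-- `ERaw.exists_hfs_parse` closes the chosen family under the permutations fixing a support `N` of
-- the conjunction. The denoted set of conjuncts stays the same, the new family is supported by `N`,
-- and it still has fewer than `κ` members because there are only countably many permutations.

theorem supp_eq_classSupp {X : Type*} [MulAction (NPerm 𝒩) X] (x : X) :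
    supp 𝒩 x = classSupp 𝒩 (fun y => x = y) x := by
  unfold supp classSupp
  congr 1
  ext N
  exact and_congr_right fun _ => ⟨fun h π hπ => (h π fun a ha => hπ a ha).symm,
    fun h π hπ => (h π fun a ha => hπ ha).symm⟩

/-- Equality is an equivariant equivalence relation, so `classSupp_spec` applies to it. Finite
support need not be assumed: without it `supp 𝒩 x` is an empty intersection, that is all names, and
`π` is the identity. -/
theorem smul_eq_of_fixes_supp {X : Type*} [MulAction (NPerm 𝒩) X] {x : X} {π : NPerm 𝒩}
    (h : ∀ a ∈ supp 𝒩 x, π • a = a) : π • x = x := by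
  rw [supp_eq_classSupp] at h
  exact (classSupp_spec (r := Eq) (fun π _ _ h => congrArg (π • ·) h) (fun _ => rfl)
    (fun _ _ => Eq.symm) (fun _ _ _ => Eq.trans) x π h).symm

theorem finite_supp_of_supports {X : Type*} [MulAction (NPerm 𝒩) X] {x : X} {N : Set 𝒩}
    (hN : N.Finite) (h : MulAction.Supports (NPerm 𝒩) N x) : (supp 𝒩 x).Finite :=
  hN.subset fun _ ha => ha N ⟨hN, h⟩

theorem Nominal.finite_supp {X : Type u} [Nominal 𝒩 X] (x : X) : (supp 𝒩 x).Finite := by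
  obtain ⟨N, hN, h⟩ := Nominal.exists_support (𝒩 := 𝒩) x
  exact finite_supp_of_supports hN h

theorem Nominal.finite_supp_prod {X Y : Type u} [Nominal 𝒩 X] [Nominal 𝒩 Y] (x : X) (y : Y) :
    (supp 𝒩 (x, y)).Finite := by
  obtain ⟨N, hN, h⟩ := Nominal.exists_support (𝒩 := 𝒩) x
  obtain ⟨M, hM, k⟩ := Nominal.exists_support (𝒩 := 𝒩) y
  exact finite_supp_of_supports (hN.union hM) fun π hπ => Prod.ext
    (h π fun a ha => hπ (Or.inl ha)) (k π fun a ha => hπ (Or.inr ha))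

theorem ClassFS.finite_classSupp {X : Type*} [MulAction (NPerm 𝒩) X] {p : X → Prop} {x : X}
    (h : ClassFS 𝒩 p x) : (classSupp 𝒩 p x).Finite := by
  obtain ⟨N, hN, hs⟩ := h
  exact hN.subset fun _ ha => ha N ⟨hN, hs⟩

/-- A finite set of names can be renamed to avoid a finite set, without moving other names than
the old and the new ones. -/
theorem exists_fresh_renaming (S : Finset 𝒩) {F : Set 𝒩} (hF : F.Finite) :
    ∃ θ : NPerm 𝒩, (∀ a ∈ S, θ • a ∉ F) ∧
      ∀ a, a ∉ S → (∀ b ∈ S, a ≠ θ • b) → θ • a = a := by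
  classical
  induction S using Finset.induction_on generalizing F with
  | empty => exact ⟨1, by simp, by simp⟩
  | insert s S hs ih =>
    -- With `s` among the forbidden names, no image `θ • b` equals `s`, so `θ` fixes `s` and can be
    -- followed by a swap of `s` with a fresh name.
    obtain ⟨θ, h1, h2⟩ := ih (hF.insert s)
    -- The name `c` avoids `F`, as the new image of `s` must, and `θ • S`, so that the swap leaves
    -- the images already chosen in place.
    obtain ⟨c, hc, hc'⟩ := ((NameSet.infinite_sort s).sdiff ((hF.insert s).union
      ((S.finite_toSet).union ((S.finite_toSet).image (θ • ·))))).nonempty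
    simp only [Set.mem_union, Set.mem_insert_iff, Finset.mem_coe, Set.mem_image, not_or,
      not_exists, not_and] at hc'
    obtain ⟨⟨hcs, hcF⟩, hcS, hcθ⟩ := hc'
    have hθs : θ • s = s := h2 s hs fun b hb he => h1 b hb (by rw [← he]; exact Or.inl rfl)
    have key : ∀ b ∈ S, nswap s c hc • θ • b = θ • b := fun b hb =>
      nswap_smul_of_ne _ _ _ (fun he => h1 b hb (by rw [he]; exact Or.inl rfl)) (hcθ b hb)
    refine ⟨nswap s c hc * θ, fun a ha => ?_, fun a ha hb => ?_⟩
    · rw [mul_smul]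
      rcases Finset.mem_insert.1 ha with rfl | ha
      · rw [hθs, nswap_smul_left]
        exact hcF
      · rw [key a ha]
        exact fun hf => h1 a ha (Or.inr hf)
    · rw [Finset.mem_insert, not_or] at ha
      rw [mul_smul, h2 a ha.2 fun b hbS he => hb b (Finset.mem_insert_of_mem hbS)
        (by rw [mul_smul, key b hbS]; exact he)]
      refine nswap_smul_of_ne _ _ _ ha.1 fun he => hb s (Finset.mem_insert_self _ _) ?_
      rw [mul_smul, hθs, nswap_smul_left, he]

/-- A permutation is determined by its graph on the finitely many names it moves, a finite subset of
a countable set. This keeps the orbits taken for finitely supported parses below `κ`. -/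
instance : Countable (NPerm 𝒩) := by
  classical
  have : Countable 𝒩 := NameSet.countable
  let g : NPerm 𝒩 → Finset (𝒩 × 𝒩) := fun π => π.2.2.toFinset.image fun a => (a, π.1 a)
  refine Function.Injective.countable (f := g) fun π ρ h => Subtype.ext (Equiv.ext fun a => ?_)
  have hg : ∀ (σ : NPerm 𝒩) a b, (a, b) ∈ g σ ↔ σ.1 a ≠ a ∧ σ.1 a = b := fun σ a b => by
    simp only [g, Finset.mem_image, Set.Finite.mem_toFinset, Prod.mk.injEq]
    exact ⟨by rintro ⟨c, hc, rfl, rfl⟩; exact ⟨hc, rfl⟩, fun h => ⟨a, h.1, rfl, h.2⟩⟩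
  by_cases hπ : π.1 a = a
  · by_contra hne
    have := (hg ρ a (ρ.1 a)).2 ⟨fun h' => hne (hπ.trans h'.symm), rfl⟩
    rw [← h, hg] at this
    exact this.1 hπ
  · have := (hg π a (π.1 a)).2 ⟨hπ, rfl⟩
    rw [h, hg] at this
    exact this.2.symm

end Fresh

/-! ### Validity of modalities -/

section Validity

variable {T : NTS 𝒩 State Pred Act}

theorem Raw.Alpha.of_fixes {A : Raw Pred Act κ} {π : NPerm 𝒩}
    (h : ∀ a ∈ classSupp 𝒩 (A.Alpha T) A, π • a = a) : A.Alpha T (π • A) :=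
  classSupp_spec (fun π _ z => Raw.Alpha.smul π z) Raw.Alpha.refl (fun _ _ => Raw.Alpha.symm)
    (fun _ _ _ => Raw.Alpha.trans) A π h

/-- The residual of a transition is an abstraction, so `(α, Q)` can be replaced by an alpha-variant
while the source `P` stays the same. -/
theorem NTS.Step.rename {P Q : State} {α : Act} (h : T.Step P α Q) {σ : NPerm 𝒩}
    (hσ : ∀ a ∈ supp 𝒩 (α, Q) \ (T.bn α : Set 𝒩), σ • a = a) : T.Step P (σ • α) (σ • Q) := by
  have : NameAbs.mk (T.bn α) (α, Q) = NameAbs.mk (T.bn (σ • α)) (σ • α, σ • Q) :=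
    Quotient.sound ⟨σ, (T.bn_smul σ α).symm, rfl, hσ⟩
  unfold NTS.Step at h ⊢
  rwa [← this]

/-- The action modality respects logical equivalence of finitely supported formulas, whatever
their supports are. -/
theorem Raw.sat_may_mono {A B : Raw Pred Act κ} (hA : ClassFS 𝒩 (A.Alpha T) A)
    (hB : ClassFS 𝒩 (B.Alpha T) B) (h : ∀ P, A.Sat T P → B.Sat T P) (α : Act) {P : State}
    (hP : (Raw.may α A).Sat T P) : (Raw.may α B).Sat T P := by
  rw [Raw.Sat] at hP ⊢
  obtain ⟨π, h1, -, P', h3, h4⟩ := hP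
  -- The given `π` respects the support of `A` only and may move free names of `B`. It is replaced
  -- by a renaming `θ` of `bn α` to names fresh for `α`, `A`, `B`, `P`, `π` and the residual.
  obtain ⟨θ, k1, k2⟩ := exists_fresh_renaming (T.bn α)
    (F := supp 𝒩 α ∪ classSupp 𝒩 (A.Alpha T) A ∪ classSupp 𝒩 (B.Alpha T) B ∪ supp 𝒩 P ∪
      {a | π.1 a ≠ a} ∪ supp 𝒩 (π • α, P'))
    ((((((Nominal.finite_supp α).union hA.finite_classSupp).union hB.finite_classSupp).union
      (Nominal.finite_supp P)).union π.2.2).union (Nominal.finite_supp_prod _ _))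
  simp only [Set.mem_union, not_or] at k1
  have hπθ : ∀ a ∈ T.bn α, π • θ • a = θ • a := fun a ha => by
    by_contra hn
    exact (k1 a ha).1.2 hn
  have hfix : ∀ a ∈ supp 𝒩 α ∪ classSupp 𝒩 (A.Alpha T) A ∪ classSupp 𝒩 (B.Alpha T) B,
      a ∉ (T.bn α : Set 𝒩) → θ • a = a := fun a ha hb => k2 a hb fun b hbn he => by
    subst he
    rcases ha with (ha | ha) | ha
    · exact (k1 b hbn).1.1.1.1.1 ha
    · exact (k1 b hbn).1.1.1.1.2 ha
    · exact (k1 b hbn).1.1.1.2 ha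
  -- Bound names are sent by `θ` to names that `π` does not move, and free names are fixed by both.
  -- Hence `θ⁻¹ * π * θ` fixes `α`, and fixes `A` up to alpha-equivalence.
  have hconj : ∀ a ∈ supp 𝒩 α ∪ classSupp 𝒩 (A.Alpha T) A, π • θ • a = θ • a := fun a ha => by
    by_cases hb : a ∈ (T.bn α : Set 𝒩)
    · exact hπθ a hb
    · rw [hfix a (Or.inl ha) hb, h1 a ⟨ha, hb⟩]
  have hα : π • θ • α = θ • α := by
    have : (θ⁻¹ * π * θ) • α = α := smul_eq_of_fixes_supp fun a ha => by
      rw [mul_smul, mul_smul, hconj a (Or.inl ha), inv_smul_smul]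
    rwa [mul_smul, mul_smul, inv_smul_eq_iff] at this
  have hAα : A.Alpha T ((θ⁻¹ * π * θ) • A) := Raw.Alpha.of_fixes fun a ha => by
    rw [mul_smul, mul_smul, hconj a (Or.inr ha), inv_smul_smul]
  -- The conjugate carries `π • α` to `π • θ • α = θ • α`. Outside `π • bn α` it can only move names
  -- of the form `θ • b` with `b ∈ bn α`, and these were chosen outside the support of the residual.
  have hstep := h3.rename (σ := π * θ * π⁻¹) (by
    rintro a ⟨ha, hb⟩
    rw [T.bn_smul, Set.mem_smul_set_iff_inv_smul_mem] at hb
    rw [mul_smul, mul_smul, k2 _ hb fun b hb' he => ?_, smul_inv_smul]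
    rw [inv_smul_eq_iff, hπθ b hb'] at he
    subst he
    exact (k1 b hb').2 ha)
  rw [mul_smul, mul_smul, mul_smul, mul_smul, inv_smul_smul, hα] at hstep
  refine ⟨θ, fun a ha => hfix a (ha.1.elim (fun h => Or.inl (Or.inl h)) Or.inr) ha.2, ?_, _,
    hstep, h _ ?_⟩
  · rw [T.bn_smul, Set.disjoint_left]
    rintro _ ⟨a, ha, rfl⟩ hs
    exact (k1 a ha).1.1.2 hs
  · rw [hAα.sat_iff]
    have := (Raw.sat_smul A (θ⁻¹ * π * θ) _).2 h4
    simpa only [mul_smul] using this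

/-- Since `bn τ` is empty, freshness is vacuous and an admissible `π` fixes the whole support of
`A`, so that `π • A` is alpha-equivalent to `A`. -/
theorem Raw.sat_may_tau_iff {A : Raw Pred Act κ} {P : State} :
    (Raw.may T.tau A).Sat T P ↔ ∃ P', T.Step P T.tau P' ∧ A.Sat T P' := by
  rw [Raw.Sat]
  constructor
  · rintro ⟨π, h1, -, P', h3, h4⟩
    rw [T.tau_smul] at h3
    refine ⟨P', h3, ?_⟩
    have : A.Alpha T (π • A) := Raw.Alpha.of_fixes fun a ha =>
      h1 a ⟨Or.inr ha, by simp [T.bn_tau]⟩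
    rw [this.sat_iff]
    simpa using (Raw.sat_smul A π _).2 h4
  · rintro ⟨P', h3, h4⟩
    exact ⟨1, by simp, by simp [T.bn_tau], P', by simpa using h3, by simpa using h4⟩

theorem Raw.sat_disj_iff {ι : Type u} {hι : #ι < κ} {f : ι → Raw Pred Act κ} {P : State} :
    (Raw.disj ι hι f).Sat T P ↔ ∃ i, (f i).Sat T P := by
  simp only [Raw.disj, Raw.Sat, not_forall, not_not]

/-- Reachability by unobservable transitions. -/
def NTS.TauReach (T : NTS 𝒩 State Pred Act) : State → State → Prop :=
  Relation.ReflTransGen fun P Q => T.Step P T.tau Q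

variable [Fact (ℵ₀ < κ)]

theorem Raw.sat_and_iff {A B : Raw Pred Act κ} {P : State} :
    (A.and B).Sat T P ↔ A.Sat T P ∧ B.Sat T P := by
  unfold Raw.and
  rw [Raw.Sat]
  exact ⟨fun h => ⟨h ⟨true⟩, h ⟨false⟩⟩, fun h b => by
    rcases b with ⟨_ | _⟩
    exacts [h.2, h.1]⟩

theorem Raw.sat_top (P : State) : (Raw.top : Raw Pred Act κ).Sat T P := by
  unfold Raw.top
  rw [Raw.Sat]
  exact fun i => i.elim

/-- The disjunct with index `n` asserts a τ-path of length exactly `n`, so the disjunction over all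
`n` is the reflexive transitive closure. -/
theorem Raw.sat_wtau_iff {A : Raw Pred Act κ} {P : State} :
    (A.wtau T).Sat T P ↔ ∃ P', T.TauReach P P' ∧ A.Sat T P' := by
  unfold Raw.wtau
  rw [Raw.sat_disj_iff]
  constructor
  · rintro ⟨⟨n⟩, h⟩
    induction n generalizing P with
    | zero => exact ⟨P, .refl, h⟩
    | succ n ih =>
      dsimp only at h
      rw [Function.iterate_succ_apply', Raw.sat_may_tau_iff] at h
      obtain ⟨Q, h1, h2⟩ := h
      obtain ⟨P', h3, h4⟩ := ih h2
      exact ⟨P', .head h1 h3, h4⟩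
  · rintro ⟨P', h1, h2⟩
    induction h1 using Relation.ReflTransGen.head_induction_on with
    | refl => exact ⟨⟨0⟩, h2⟩
    | head h _ ih =>
      obtain ⟨⟨n⟩, hn⟩ := ih
      refine ⟨⟨n + 1⟩, ?_⟩
      dsimp only
      rw [Function.iterate_succ_apply', Raw.sat_may_tau_iff]
      exact ⟨_, h, hn⟩

theorem Raw.sat_wtau_mono {A B : Raw Pred Act κ} (h : ∀ P, A.Sat T P → B.Sat T P) (P : State)
    (hP : (A.wtau T).Sat T P) : (B.wtau T).Sat T P := by
  rw [Raw.sat_wtau_iff] at hP ⊢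
  exact hP.imp fun Q hQ => hQ.imp_right (h Q)

/-- Finite support serves only the binder `⟨α⟩` between the two `⟪τ⟫`, which bind nothing. -/
theorem Raw.sat_wmay_mono {A B : Raw Pred Act κ} (hA : A.Hfs T) (hB : B.Hfs T)
    (h : ∀ P, A.Sat T P → B.Sat T P) (α : Act) {P : State}
    (hP : (A.wmay T α).Sat T P) : (B.wmay T α).Sat T P := by
  unfold Raw.wmay at hP ⊢
  split_ifs at hP ⊢
  · exact Raw.sat_wtau_mono h P hP
  · exact Raw.sat_wtau_mono (fun Q => Raw.sat_may_mono hA.wtau.classFS hB.wtau.classFS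
      (Raw.sat_wtau_mono h) α) P hP

end Validity

/-! ### Normal preformulas -/

section NormalPreformulas

/-- Permutation of raw normal preformulas. -/
def NRaw.perm (π : NPerm 𝒩) : NRaw Pred Act κ → NRaw Pred Act κ
  | .leaf A φ => .leaf (π • A) (π • φ)
  | .disj ι h f => .disj ι h fun i => (f i).perm π

theorem NRaw.perm_one (C : NRaw Pred Act κ) : C.perm (1 : NPerm 𝒩) = C := by
  induction C with
  | leaf A φ => simp [NRaw.perm]
  | disj ι h f ih => simp [NRaw.perm, ih]

theorem NRaw.perm_mul (π ρ : NPerm 𝒩) (C : NRaw Pred Act κ) :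
    C.perm (π * ρ) = (C.perm ρ).perm π := by
  induction C with
  | leaf A φ => simp [NRaw.perm, mul_smul]
  | disj ι h f ih => simp [NRaw.perm, ih]

instance : MulAction (NPerm 𝒩) (NRaw Pred Act κ) where
  smul π C := C.perm π
  one_smul := NRaw.perm_one
  mul_smul := NRaw.perm_mul

@[simp] theorem NRaw.smul_leaf (π : NPerm 𝒩) (A : Raw Pred Act κ) (φ : Pred) :
    π • NRaw.leaf A φ = NRaw.leaf (π • A) (π • φ) := rfl

@[simp] theorem NRaw.smul_disj (π : NPerm 𝒩) (ι : Type u) (h : #ι < κ)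
    (f : ι → NRaw Pred Act κ) : π • NRaw.disj ι h f = NRaw.disj ι h fun i => π • f i := rfl

/-- Alpha-equivalence of raw normal preformulas. -/
def NRaw.Alpha (T : NTS 𝒩 State Pred Act) : NRaw Pred Act κ → NRaw Pred Act κ → Prop
  | .leaf A φ, .leaf B ψ => A.Alpha T B ∧ φ = ψ
  | .disj _ _ f, .disj _ _ g => SameSet (fun i => (f i).Alpha T) g
  | _, _ => False

/-- Every conjunction and disjunction in the normal preformula is over a finitely supported
set. -/
def NRaw.Hfs (T : NTS 𝒩 State Pred Act) : NRaw Pred Act κ → Prop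
  | .leaf A _ => A.Hfs T
  | .disj ι h f => ClassFS 𝒩 ((NRaw.disj ι h f).Alpha T) (.disj ι h f) ∧ ∀ i, (f i).Hfs T

/-- Validity of normal preformulas. -/
def NRaw.Sat (T : NTS 𝒩 State Pred Act) : NRaw Pred Act κ → State → Prop
  | .leaf A φ, P => A.Sat T P ∧ T.entails P φ
  | .disj _ _ f, P => ∃ i, (f i).Sat T P

variable {T : NTS 𝒩 State Pred Act} [Fact (ℵ₀ < κ)]

theorem NRaw.delta_smul (π : NPerm 𝒩) (C : NRaw Pred Act κ) :
    (π • C).delta T = π • C.delta T := by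
  induction C with
  | leaf A φ => simp [NRaw.delta, Raw.smul_wtau, Raw.smul_and]
  | disj ι h f ih => simp [NRaw.delta, Raw.smul_disj, ih]

theorem NRaw.eps_smul (π : NPerm 𝒩) (A : Raw Pred Act κ) (C : NRaw Pred Act κ) :
    (π • C).eps (π • A) = π • C.eps A := by
  induction C with
  | leaf A' φ => simp [NRaw.eps, Raw.smul_and]
  | disj ι h f ih => simp [NRaw.eps, ih]

theorem NRaw.Alpha.delta : ∀ {C D : NRaw Pred Act κ}, C.Alpha T D →
    (C.delta T).Alpha T (D.delta T)
  | .leaf A φ, D, h => by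
    cases D <;> simp only [NRaw.Alpha] at h
    rw [NRaw.delta, NRaw.delta]
    exact (h.1.and (by rw [Raw.Alpha]; exact h.2)).wtau
  | .disj _ _ f, D, h => by
    cases D <;> simp only [NRaw.Alpha] at h
    rw [NRaw.delta, NRaw.delta]
    exact Raw.Alpha.disj (h.map fun i j h => NRaw.Alpha.delta h)

theorem NRaw.Alpha.eps {A B : Raw Pred Act κ} (hAB : A.Alpha T B) :
    ∀ {C D : NRaw Pred Act κ}, C.Alpha T D → (C.eps A).Alpha T (D.eps B)
  | .leaf A φ, D, h => by
    cases D <;> simp only [NRaw.Alpha] at h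
    rw [NRaw.eps, NRaw.eps, NRaw.Alpha]
    exact ⟨hAB.and h.1, h.2⟩
  | .disj _ _ f, D, h => by
    cases D <;> simp only [NRaw.Alpha] at h
    rw [NRaw.eps, NRaw.eps, NRaw.Alpha]
    exact h.map fun i j h => NRaw.Alpha.eps hAB h

/-- If `N` supports the class of a disjunction, then it supports the class of its image, because `δ`
is equivariant and respects alpha-equivalence. The other preservation lemmas for `Hfs` rest on the
same argument. -/
theorem NRaw.Hfs.delta : ∀ {C : NRaw Pred Act κ}, C.Hfs T → (C.delta T).Hfs T
  | .leaf A φ, h => by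
    rw [NRaw.Hfs] at h
    rw [NRaw.delta]
    exact (h.and (by rw [Raw.Hfs]; trivial)).wtau
  | .disj ι hι f, h => by
    rw [NRaw.Hfs] at h
    obtain ⟨⟨N, hN, hs⟩, h2⟩ := h
    have key : ClassFS 𝒩 (((NRaw.disj ι hι f).delta T).Alpha T) ((NRaw.disj ι hι f).delta T) :=
      ⟨N, hN, fun π hπ => by
        rw [← NRaw.delta_smul]
        exact (hs π hπ).delta⟩
    rw [NRaw.delta] at key ⊢
    exact Raw.Hfs.disj key fun i => (h2 i).delta

theorem NRaw.Hfs.eps {A : Raw Pred Act κ} (hA : A.Hfs T) :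
    ∀ {C : NRaw Pred Act κ}, C.Hfs T → (C.eps A).Hfs T
  | .leaf A φ, h => by
    rw [NRaw.Hfs] at h
    rw [NRaw.eps, NRaw.Hfs]
    exact hA.and h
  | .disj ι hι f, h => by
    rw [NRaw.Hfs] at h
    obtain ⟨⟨N, hN, hs⟩, h2⟩ := h
    obtain ⟨M, hM, ht⟩ := hA.classFS
    have key : ClassFS 𝒩 (((NRaw.disj ι hι f).eps A).Alpha T) ((NRaw.disj ι hι f).eps A) :=
      -- Equivariance of `ε` is joint in both arguments, so a support of `A` has to be added.
      ⟨N ∪ M, hN.union hM, fun π hπ => by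
        rw [← NRaw.eps_smul]
        exact NRaw.Alpha.eps (ht π fun a ha => hπ a (Or.inr ha))
          (hs π fun a ha => hπ a (Or.inl ha))⟩
    rw [NRaw.eps] at key ⊢
    rw [NRaw.Hfs]
    exact ⟨key, fun i => NRaw.Hfs.eps hA (h2 i)⟩

/-- Conjunction is associative at the leaves and distributes over the disjunctions. -/
theorem NRaw.sat_eps_iff {A : Raw Pred Act κ} {P : State} (C : NRaw Pred Act κ) :
    (C.eps A).Sat T P ↔ A.Sat T P ∧ C.Sat T P := by
  induction C with
  | leaf A' φ => rw [NRaw.eps, NRaw.Sat, NRaw.Sat, Raw.sat_and_iff, and_assoc]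
  | disj ι h f ih => simp only [NRaw.eps, NRaw.Sat, ih, exists_and_left]

/-- This is the commutation of `⟪τ⟫` with disjunction: the choice of a τ-descendant and the choice
of a disjunct are both existential, hence interchangeable. -/
theorem NRaw.sat_delta_iff {P : State} (C : NRaw Pred Act κ) :
    (C.delta T).Sat T P ↔ ∃ P', T.TauReach P P' ∧ C.Sat T P' := by
  induction C with
  | leaf A φ => simp only [NRaw.delta, NRaw.Sat, Raw.sat_wtau_iff, Raw.sat_and_iff, Raw.Sat]
  | disj ι h f ih =>
    simp only [NRaw.delta, NRaw.Sat, Raw.sat_disj_iff, ih]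
    rw [exists_comm]
    simp only [exists_and_left]

end NormalPreformulas

/-! ### Properties of the normalisation -/

section Normalisation

variable {T : NTS 𝒩 State Pred Act} [Fact (ℵ₀ < κ)]

theorem Raw.smul_top (π : NPerm 𝒩) : π • (Raw.top : Raw Pred Act κ) = .top := by
  unfold Raw.top
  rw [Raw.smul_conj]
  congr 1
  funext i
  exact i.elim

theorem Raw.Hfs.top : (Raw.top : Raw Pred Act κ).Hfs T := by
  have key : ClassFS 𝒩 ((Raw.top : Raw Pred Act κ).Alpha T) .top :=
    ⟨∅, Set.finite_empty, fun π _ => by rw [Raw.smul_top]; exact Raw.Alpha.refl _⟩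
  unfold Raw.top at key ⊢
  rw [Raw.Hfs]
  exact ⟨key, fun i => i.elim⟩

theorem Raw.Weak.top : (Raw.top : Raw Pred Act κ).Weak T := .conj _ _ _ fun i => i.elim

theorem Raw.Weak.and {A B : Raw Pred Act κ} (hA : A.Weak T) (hB : B.Weak T) :
    (A.and B).Weak T :=
  .conj _ _ _ fun b => by
    rcases b with ⟨_ | _⟩
    exacts [hB, hA]

theorem Raw.Weak.disj {ι : Type u} {hι : #ι < κ} {f : ι → Raw Pred Act κ}
    (h : ∀ i, (f i).Weak T) : (Raw.disj ι hι f).Weak T :=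
  .neg _ (.conj _ _ _ fun i => .neg _ (h i))

/-- The formulas at the leaves of the normal preformula are weak. -/
def NRaw.Weak (T : NTS 𝒩 State Pred Act) : NRaw Pred Act κ → Prop
  | .leaf A _ => A.Weak T
  | .disj _ _ f => ∀ i, (f i).Weak T

theorem NRaw.Weak.eps {A : Raw Pred Act κ} (hA : A.Weak T) {C : NRaw Pred Act κ}
    (h : C.Weak T) : (C.eps A).Weak T := by
  induction C with
  | leaf A' φ => exact hA.and h
  | disj ι hι f ih => exact fun i => ih i (h i)

/-- The normal form exists for this lemma: `⟪τ⟫` now stands directly in front of some `A ∧ φ` with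
`A` weak, the only position in which the weak grammar admits a state predicate. -/
theorem NRaw.Weak.delta {C : NRaw Pred Act κ} (h : C.Weak T) : (C.delta T).Weak T := by
  induction C with
  | leaf A φ => exact .wtau_and A φ h
  | disj ι hι f ih => exact Raw.Weak.disj fun i => ih i (h i)

mutual
theorem ERaw.normalise_smul (π : NPerm 𝒩) :
    ∀ E : ERaw Pred Act κ, (π • E).normalise T = π • E.normalise T
  | .conj ι h f => by
    simp [ERaw.normalise, fun i => ERaw.normalise_smul π (f i)]
  | .neg E => by simp [ERaw.normalise, ERaw.normalise_smul π E]
  | .wmay α E => by simp [ERaw.normalise, ERaw.normalise_smul π E, Raw.smul_wmay]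
  | .wtau B => by simp [ERaw.normalise, BRaw.normalise_smul π B, NRaw.delta_smul]
theorem BRaw.normalise_smul (π : NPerm 𝒩) :
    ∀ B : BRaw Pred Act κ, (π • B).normalise T = π • B.normalise T
  | .and E B => by
    simp [BRaw.normalise, ERaw.normalise_smul π E, BRaw.normalise_smul π B, NRaw.eps_smul]
  | .pred φ => by simp [BRaw.normalise, Raw.smul_top]
  | .disj ι h f => by
    simp [BRaw.normalise, fun i => BRaw.normalise_smul π (f i)]
end

mutual
-- In the case of `⟪α⟫`, alpha-equivalence renames the body under the binder, so the induction needs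
-- that `Δ` commutes with renaming, besides the induction hypothesis.
theorem ERaw.Alpha.normalise : ∀ {E E' : ERaw Pred Act κ}, E.Alpha T E' →
    (E.normalise T).Alpha T (E'.normalise T)
  | .conj _ _ f, B, h => by
    cases B <;> simp only [ERaw.Alpha] at h
    rw [ERaw.normalise, ERaw.normalise, Raw.Alpha]
    exact h.map fun i j h => ERaw.Alpha.normalise h
  | .neg A, B, h => by
    cases B <;> simp only [ERaw.Alpha] at h
    rw [ERaw.normalise, ERaw.normalise, Raw.Alpha]
    exact ERaw.Alpha.normalise h
  | .wmay α A, B, h => by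
    cases B <;> simp only [ERaw.Alpha] at h
    rw [ERaw.normalise, ERaw.normalise]
    exact Raw.wmay_alpha (h.map (fun π x => ERaw.normalise_smul π x)
      fun z hz => ERaw.Alpha.normalise hz)
  | .wtau A, B, h => by
    cases B <;> simp only [ERaw.Alpha] at h
    rw [ERaw.normalise, ERaw.normalise]
    exact (BRaw.Alpha.normalise h).delta
theorem BRaw.Alpha.normalise : ∀ {E E' : BRaw Pred Act κ}, E.Alpha T E' →
    (E.normalise T).Alpha T (E'.normalise T)
  | .and E A, B, h => by
    cases B <;> simp only [BRaw.Alpha] at h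
    rw [BRaw.normalise, BRaw.normalise]
    exact NRaw.Alpha.eps (ERaw.Alpha.normalise h.1) (BRaw.Alpha.normalise h.2)
  | .pred φ, B, h => by
    cases B <;> simp only [BRaw.Alpha] at h
    rw [BRaw.normalise, BRaw.normalise, NRaw.Alpha]
    exact ⟨Raw.Alpha.refl _, h⟩
  | .disj _ _ f, B, h => by
    cases B <;> simp only [BRaw.Alpha] at h
    rw [BRaw.normalise, BRaw.normalise, NRaw.Alpha]
    exact h.map fun i j h => BRaw.Alpha.normalise h
end

mutual
theorem ERaw.Hfs.normalise : ∀ {E : ERaw Pred Act κ}, E.Hfs T → (E.normalise T).Hfs T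
  | .conj ι h f, hE => by
    rw [ERaw.Hfs] at hE
    obtain ⟨⟨N, hN, hs⟩, h2⟩ := hE
    have key : ClassFS 𝒩 (((ERaw.conj ι h f).normalise T).Alpha T)
        ((ERaw.conj ι h f).normalise T) :=
      ⟨N, hN, fun π hπ => by
        rw [← ERaw.normalise_smul]
        exact (hs π hπ).normalise⟩
    rw [ERaw.normalise] at key ⊢
    rw [Raw.Hfs]
    exact ⟨key, fun i => (h2 i).normalise⟩
  | .neg E, hE => by
    rw [ERaw.Hfs] at hE
    rw [ERaw.normalise, Raw.Hfs]
    exact hE.normalise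
  | .wmay α E, hE => by
    rw [ERaw.Hfs] at hE
    rw [ERaw.normalise]
    exact (ERaw.Hfs.normalise hE).wmay α
  | .wtau B, hE => by
    rw [ERaw.Hfs] at hE
    rw [ERaw.normalise]
    exact (BRaw.Hfs.normalise hE).delta
theorem BRaw.Hfs.normalise : ∀ {B : BRaw Pred Act κ}, B.Hfs T → (B.normalise T).Hfs T
  | .and E B, hE => by
    rw [BRaw.Hfs] at hE
    rw [BRaw.normalise]
    exact NRaw.Hfs.eps (ERaw.Hfs.normalise hE.1) (BRaw.Hfs.normalise hE.2)
  | .pred φ, _ => by rw [BRaw.normalise, NRaw.Hfs]; exact Raw.Hfs.top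
  | .disj ι h f, hE => by
    rw [BRaw.Hfs] at hE
    obtain ⟨⟨N, hN, hs⟩, h2⟩ := hE
    have key : ClassFS 𝒩 (((BRaw.disj ι h f).normalise T).Alpha T)
        ((BRaw.disj ι h f).normalise T) :=
      ⟨N, hN, fun π hπ => by
        rw [← BRaw.normalise_smul]
        exact (hs π hπ).normalise⟩
    rw [BRaw.normalise] at key ⊢
    rw [NRaw.Hfs]
    exact ⟨key, fun i => (h2 i).normalise⟩
end

mutual
theorem ERaw.normalise_weak : ∀ E : ERaw Pred Act κ, (E.normalise T).Weak T
  | .conj ι h f => by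
    rw [ERaw.normalise]
    exact .conj _ _ _ fun i => ERaw.normalise_weak (f i)
  | .neg E => by
    rw [ERaw.normalise]
    exact .neg _ (ERaw.normalise_weak E)
  | .wmay α E => by
    rw [ERaw.normalise]
    exact .wmay _ _ (ERaw.normalise_weak E)
  | .wtau B => by
    rw [ERaw.normalise]
    exact (BRaw.normalise_weak B).delta
theorem BRaw.normalise_weak : ∀ B : BRaw Pred Act κ, (B.normalise T).Weak T
  | .and E B => by
    rw [BRaw.normalise]
    exact NRaw.Weak.eps (ERaw.normalise_weak E) (BRaw.normalise_weak B)
  | .pred φ => by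
    rw [BRaw.normalise]
    exact Raw.Weak.top
  | .disj ι h f => by
    rw [BRaw.normalise]
    exact fun i => BRaw.normalise_weak (f i)
end

mutual
-- Finite support of the expression is needed in the case of `⟪α⟫`, where fresh bound names must be
-- found for `Δ(E)` and the formula denoted by `E` simultaneously.
theorem ERaw.Hfs.sat_normalise_iff : ∀ {E : ERaw Pred Act κ}, E.Hfs T → ∀ P : State,
    (E.normalise T).Sat T P ↔ (E.interp T).Sat T P
  | .conj ι h f, hE, P => by
    rw [ERaw.Hfs] at hE
    rw [ERaw.normalise, ERaw.interp, Raw.Sat, Raw.Sat]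
    exact forall_congr' fun i => ERaw.Hfs.sat_normalise_iff (hE.2 i) P
  | .neg E, hE, P => by
    rw [ERaw.Hfs] at hE
    rw [ERaw.normalise, ERaw.interp, Raw.Sat, Raw.Sat]
    exact not_congr (ERaw.Hfs.sat_normalise_iff hE P)
  | .wmay α E, hE, P => by
    rw [ERaw.Hfs] at hE
    rw [ERaw.normalise, ERaw.interp]
    have ih := ERaw.Hfs.sat_normalise_iff hE
    exact ⟨Raw.sat_wmay_mono hE.normalise hE.interp (fun Q => (ih Q).1) α,
      Raw.sat_wmay_mono hE.interp hE.normalise (fun Q => (ih Q).2) α⟩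
  | .wtau B, hE, P => by
    rw [ERaw.Hfs] at hE
    rw [ERaw.normalise, ERaw.interp, NRaw.sat_delta_iff, Raw.sat_wtau_iff]
    exact exists_congr fun Q => and_congr_right fun _ => BRaw.Hfs.sat_normalise_iff hE Q
theorem BRaw.Hfs.sat_normalise_iff : ∀ {B : BRaw Pred Act κ}, B.Hfs T → ∀ P : State,
    (B.normalise T).Sat T P ↔ (B.interp T).Sat T P
  | .and E B, hE, P => by
    rw [BRaw.Hfs] at hE
    rw [BRaw.normalise, BRaw.interp, NRaw.sat_eps_iff, Raw.sat_and_iff]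
    exact and_congr (ERaw.Hfs.sat_normalise_iff hE.1 P) (BRaw.Hfs.sat_normalise_iff hE.2 P)
  | .pred φ, _, P => by
    rw [BRaw.normalise, BRaw.interp, NRaw.Sat, Raw.Sat]
    exact and_iff_right (Raw.sat_top P)
  | .disj ι h f, hE, P => by
    rw [BRaw.Hfs] at hE
    rw [BRaw.normalise, BRaw.interp, NRaw.Sat, Raw.sat_disj_iff]
    exact exists_congr fun i => BRaw.Hfs.sat_normalise_iff (hE.2 i) P
end

end Normalisation

/-! ### Finitely supported parses -/

section Parses

variable {T : NTS 𝒩 State Pred Act}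

/-- The permutations that fix all names in `N`. -/
abbrev Fixing (N : Set 𝒩) : Type u := {π : NPerm 𝒩 // ∀ a ∈ N, π • a = a}

/-- A product of two cardinals below an infinite `κ` is below `κ`, so no regularity of `κ` is
involved. -/
theorem mk_prod_fixing_lt [hκ : Fact (ℵ₀ < κ)] {ι : Type u} (hι : #ι < κ) (N : Set 𝒩) :
    #(ι × Fixing N) < κ := by
  rw [Cardinal.mk_prod, Cardinal.lift_id, Cardinal.lift_id]
  exact Cardinal.mul_lt_of_lt hκ.out.le hι (card_lt_of_countable _)

/-- The orbit of a family under the permutations that fix `N` is supported by `N`. -/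
theorem SameSet.orbit {X : Type*} [MulAction (NPerm 𝒩) X] {r : X → X → Prop} (hr : ∀ x, r x x)
    {ι : Type u} (f : ι → X) {N : Set 𝒩} {π : NPerm 𝒩} (hπ : ∀ a ∈ N, π • a = a) :
    SameSet (fun p : ι × Fixing N => r (p.2.1 • f p.1))
      fun p : ι × Fixing N => π • p.2.1 • f p.1 := by
  have hπ' : ∀ a ∈ N, π⁻¹ • a = a := fun a ha => by rw [inv_smul_eq_iff, hπ a ha]
  -- The permutation `π` acts on the orbit by left multiplication of the indices, with inverse
  -- `π⁻¹`, and both fix `N`.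
  refine ⟨fun p => ⟨(p.1, ⟨π⁻¹ * p.2.1, fun a ha => ?_⟩), ?_⟩,
    fun p => ⟨(p.1, ⟨π * p.2.1, fun a ha => ?_⟩), ?_⟩⟩
  · rw [mul_smul, p.2.2 a ha, hπ' a ha]
  · dsimp only
    rw [mul_smul, smul_inv_smul]
    exact hr _
  · rw [mul_smul, p.2.2 a ha, hπ a ha]
  · dsimp only
    rw [mul_smul]
    exact hr _

/-- If `N` supports the set of the `f i` and `g i ≈ f i`, then the orbit of the family `g` under
the permutations that fix `N` has the same set of members as `f`. -/
theorem SameSet.orbit_of_supports {ι : Type u} {f g : ι → Raw Pred Act κ} {N : Set 𝒩}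
    (hs : ∀ π : NPerm 𝒩, (∀ a ∈ N, π • a = a) →
      SameSet (fun i => (f i).Alpha T) fun i => π • f i)
    (h : ∀ i, (g i).Alpha T (f i)) :
    SameSet (fun p : ι × Fixing N => (p.2.1 • g p.1).Alpha T) f := by
  refine ⟨fun p => ?_, fun j => ⟨(j, ⟨1, by simp⟩), by simpa using h j⟩⟩
  -- A translate of `g` is alpha-equivalent to the same translate of `f`, which is again some `f i`
  -- because the permutation fixes `N`. Conversely, the identity permutation recovers each `f j`.
  obtain ⟨i, hi⟩ := (hs p.2.1 p.2.2).2 p.1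
  exact ⟨i, (Raw.Alpha.smul p.2.1 _ (h p.1)).trans hi.symm⟩

/-- The negations inside and around the conjunction can be stripped because alpha-equivalence of
negations is alpha-equivalence of their bodies. -/
theorem Raw.Hfs.of_disj {ι : Type u} {hι : #ι < κ} {f : ι → Raw Pred Act κ}
    (h : (Raw.disj ι hι f).Hfs T) :
    (∃ N : Set 𝒩, N.Finite ∧ ∀ π : NPerm 𝒩, (∀ a ∈ N, π • a = a) →
      SameSet (fun i => (f i).Alpha T) fun i => π • f i) ∧ ∀ i, (f i).Hfs T := by
  unfold Raw.disj at h
  rw [Raw.Hfs, Raw.Hfs] at h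
  obtain ⟨⟨N, hN, hs⟩, h2⟩ := h
  refine ⟨⟨N, hN, fun π hπ => ?_⟩, fun i => by simpa only [Raw.Hfs] using h2 i⟩
  have := hs π hπ
  rw [Raw.smul_conj, Raw.Alpha] at this
  exact this.map (r := Raw.Alpha T) fun i j h => by rwa [Raw.smul_neg, Raw.Alpha] at h

variable [Fact (ℵ₀ < κ)]

theorem Raw.Hfs.of_wtau {A : Raw Pred Act κ} (h : (A.wtau T).Hfs T) : A.Hfs T :=
  -- The disjunct with index `0` is `A` itself.
  h.of_disj.2 ⟨0⟩

theorem Raw.Hfs.of_wmay {A : Raw Pred Act κ} {α : Act} (h : (A.wmay T α).Hfs T) : A.Hfs T := by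
  unfold Raw.wmay at h
  split_ifs at h
  · exact h.of_wtau
  · have := h.of_wtau
    rw [Raw.Hfs] at this
    exact this.of_wtau

theorem Raw.Hfs.of_and {A B : Raw Pred Act κ} (h : (A.and B).Hfs T) : A.Hfs T ∧ B.Hfs T := by
  unfold Raw.and at h
  rw [Raw.Hfs] at h
  exact ⟨h.2 ⟨true⟩, h.2 ⟨false⟩⟩

mutual
/-- An expression that denotes a hereditarily finitely supported formula can be replaced by one
that is itself hereditarily finitely supported. -/
theorem ERaw.exists_hfs_parse : ∀ {E : ERaw Pred Act κ}, (E.interp T).Hfs T →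
    ∃ E' : ERaw Pred Act κ, E'.Hfs T ∧ (E'.interp T).Alpha T (E.interp T)
  | .conj ι hι f, hE => by
    rw [ERaw.interp, Raw.Hfs] at hE
    obtain ⟨⟨N, hN, hs⟩, h2⟩ := hE
    -- This choice is not equivariant, and parses are not unique: `⟪τ⟫` of the empty disjunction
    -- arises both through `wmay` and through `wtau`. So `g` as a family may lack finite support,
    -- and its orbit under the permutations fixing `N` is used instead.
    choose g hg hgf using fun i => ERaw.exists_hfs_parse (h2 i)
    refine ⟨.conj (ι × Fixing N) (mk_prod_fixing_lt hι N) fun p => p.2.1 • g p.1, ?_, ?_⟩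
    · rw [ERaw.Hfs]
      refine ⟨⟨N, hN, fun π hπ => ?_⟩, fun p => (hg p.1).smul _⟩
      rw [ERaw.smul_conj, ERaw.Alpha]
      exact SameSet.orbit ERaw.Alpha.refl g hπ
    · rw [ERaw.interp, ERaw.interp, Raw.Alpha]
      simp only [ERaw.interp_smul]
      refine SameSet.orbit_of_supports (fun π hπ => ?_) hgf
      have := hs π hπ
      rwa [Raw.smul_conj, Raw.Alpha] at this
  | .neg E, hE => by
    rw [ERaw.interp, Raw.Hfs] at hE
    obtain ⟨E', h1, h2⟩ := ERaw.exists_hfs_parse hE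
    refine ⟨.neg E', by rwa [ERaw.Hfs], ?_⟩
    rwa [ERaw.interp, ERaw.interp, Raw.Alpha]
  | .wmay α E, hE => by
    rw [ERaw.interp] at hE
    obtain ⟨E', h1, h2⟩ := ERaw.exists_hfs_parse hE.of_wmay
    refine ⟨.wmay α E', by rwa [ERaw.Hfs], ?_⟩
    rw [ERaw.interp, ERaw.interp]
    exact Raw.wmay_alpha ⟨1, by simp, by simpa using h2, by simp⟩
  | .wtau B, hE => by
    rw [ERaw.interp] at hE
    obtain ⟨B', h1, h2⟩ := BRaw.exists_hfs_parse hE.of_wtau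
    refine ⟨.wtau B', by rwa [ERaw.Hfs], ?_⟩
    rw [ERaw.interp, ERaw.interp]
    exact h2.wtau
/-- A preformula expression that denotes a hereditarily finitely supported formula can be replaced
by one that is itself hereditarily finitely supported. -/
theorem BRaw.exists_hfs_parse : ∀ {B : BRaw Pred Act κ}, (B.interp T).Hfs T →
    ∃ B' : BRaw Pred Act κ, B'.Hfs T ∧ (B'.interp T).Alpha T (B.interp T)
  | .and E B, hE => by
    rw [BRaw.interp] at hE
    obtain ⟨E', h1, h2⟩ := ERaw.exists_hfs_parse hE.of_and.1
    obtain ⟨B', h3, h4⟩ := BRaw.exists_hfs_parse hE.of_and.2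
    refine ⟨.and E' B', by rw [BRaw.Hfs]; exact ⟨h1, h3⟩, ?_⟩
    rw [BRaw.interp, BRaw.interp]
    exact h2.and h4
  | .pred φ, _ => ⟨.pred φ, by rw [BRaw.Hfs]; trivial, Raw.Alpha.refl _⟩
  | .disj ι hι f, hE => by
    rw [BRaw.interp] at hE
    obtain ⟨⟨N, hN, hs⟩, h2⟩ := hE.of_disj
    -- As for conjunctions, the chosen parses are made finitely supported by passing to their orbit.
    choose g hg hgf using fun i => BRaw.exists_hfs_parse (h2 i)
    refine ⟨.disj (ι × Fixing N) (mk_prod_fixing_lt hι N) fun p => p.2.1 • g p.1, ?_, ?_⟩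
    · rw [BRaw.Hfs]
      refine ⟨⟨N, hN, fun π hπ => ?_⟩, fun p => (hg p.1).smul _⟩
      rw [BRaw.smul_disj, BRaw.Alpha]
      exact SameSet.orbit BRaw.Alpha.refl g hπ
    · rw [BRaw.interp, BRaw.interp]
      simp only [BRaw.interp_smul]
      exact Raw.Alpha.disj (SameSet.orbit_of_supports hs hgf)
end

end Parses

/-! ### The normalisation of extended weak formulas -/

section EFormula

variable {T : NTS 𝒩 State Pred Act} [Fact (ℵ₀ < κ)]

/-- The normalisation of extended weak formulas. -/
noncomputable def EFormula.normalise : EFormula κ T → Formula κ T :=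
  Quotient.map (sa := ERaw.setoid κ T) (sb := Raw.setoid κ T)
    (fun E => ⟨E.1.normalise T, E.2.normalise⟩) fun _ _ h => ERaw.Alpha.normalise h

theorem EFormula.normalise_smul (π : NPerm 𝒩) (E : EFormula κ T) :
    (π • E).normalise = π • E.normalise := by
  induction E using Quotient.ind with
  | _ E =>
    refine Quotient.sound ?_
    change Raw.Alpha T _ _
    dsimp only
    rw [ERaw.normalise_smul]
    exact Raw.Alpha.refl _

theorem EFormula.normalise_isWeak (E : EFormula κ T) : E.normalise.IsWeak := by
  induction E using Quotient.ind with
  | _ E => exact ⟨_, E.2.normalise, E.1.normalise_weak, rfl⟩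

theorem EFormula.toFormula_equivalent_normalise (E : EFormula κ T) :
    E.toFormula.Equivalent E.normalise := by
  induction E using Quotient.ind with
  | _ E => exact fun P => (E.2.sat_normalise_iff P).symm

theorem Formula.IsExtendedWeak.exists_toFormula_eq {A : Formula κ T} (hA : A.IsExtendedWeak) :
    ∃ E : EFormula κ T, E.toFormula = A := by
  obtain ⟨E, hE, rfl⟩ := hA
  obtain ⟨E', h1, h2⟩ := ERaw.exists_hfs_parse hE
  exact ⟨.mk E' h1, Quotient.sound h2⟩

end EFormula

end NominalHML

-- The theorem

theorem mainTheorem10 {𝒩 State Pred Act : Type u} [NominalHML.NameSet 𝒩]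
    [NominalHML.Nominal 𝒩 State] [NominalHML.Nominal 𝒩 Pred] [NominalHML.Nominal 𝒩 Act]
    (T : NominalHML.NTS 𝒩 State Pred Act) (κ : Cardinal.{u})
    [Fact (Cardinal.aleph0 < κ)] (hκ : Cardinal.mk State < κ) :
    ∃ Δ : NominalHML.EFormula κ T → NominalHML.Formula κ T,
      (∀ (R : NominalHML.ERaw Pred Act κ) (hR : R.Hfs T),
        ∃ h : (R.normalise T).Hfs T, Δ (.mk R hR) = .mk (R.normalise T) h) ∧
      (∀ (π : NominalHML.NPerm 𝒩) (E : NominalHML.EFormula κ T), Δ (π • E) = π • Δ E) ∧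
      (∀ E : NominalHML.EFormula κ T, (Δ E).IsWeak ∧ E.toFormula.Equivalent (Δ E)) ∧
      (∀ A : NominalHML.Formula κ T, A.IsExtendedWeak →
        ∃ E : NominalHML.EFormula κ T, E.toFormula = A ∧ (Δ E).IsWeak ∧
          A.Equivalent (Δ E)) := by
  -- The map is induced on alpha-classes by the recursion on raw expressions, so its value at a
  -- representative is the class of the raw result by computation.
  refine ⟨NominalHML.EFormula.normalise, fun R hR => ⟨hR.normalise, rfl⟩,
    NominalHML.EFormula.normalise_smul, fun E => ⟨E.normalise_isWeak,
      E.toFormula_equivalent_normalise⟩, fun A hA => ?_⟩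
  obtain ⟨E, rfl⟩ := hA.exists_toFormula_eq
  exact ⟨E, rfl, E.normalise_isWeak, E.toFormula_equivalent_normalise⟩
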